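/- All graphs are finite and simple. A graph is *subcubic* if it is connected and its maximum vertex degree is at most $3$. A set $D$ of vertices of a graph $G$ is a *connected dominating set* if every vertex outside $D$ has a neighbour in $D$ and the induced subgraph $G[D]$ is connected (in particular, $D\neq\emptyset$). Two disjoint vertex sets form a *connected coalition* in $G$ if neither of them is a connected dominating set but their union is. A *connected coalition partition* of $G$ is a partition $\pi=\{V_1,\dots,V_k\}$ of $V(G)$ into nonempty sets such that each $V_i$ either is a connected dominating set consisting of a single vertex or forms a connected coalition with some $V_j\in\pi$. The *coalition graph* $CCG(G,\pi)$ has vertex set $\pi$, and $V_i,V_j$ are adjacent if and only if they form a connected coalition in $G$. Notation: $K_n$, $P_n$, $C_n$, $S_n$ are the complete graph, path, cycle and star of order $n$ (so $S_n=K_{1,n-1}$); $K_{p,q}$ is the complete bipartite graph with parts of sizes $p,q$; $\overline{F}$ is the complement of $F$; $mF$ is the disjoint union of $m$ copies of $F$, and $\cup$ denotes disjoint union; $K_4-e$ is $K_4$ with one edge removed; $C_3+e$ and $C_4+e$ are $C_3$ and $C_4$ with one pendant edge attached; $C_3+2e$ is $C_3$ with two pendant edges attached at the same vertex; $C_3+e+e$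 is $C_3$ with two pendant edges attached at two different vertices; $S_{p,q}$ is the double star formed by two adjacent vertices with $p$, respectively $q$, leaves attached to them. **Theorem.** A graph $H$ is isomorphic to $CCG(G,\pi)$ for some subcubic graph $G$ and some connected coalition partition $\pi$ of $G$ if and only if $H$ is isomorphic to a star $S_k$ with $k\ge 2$ or to one of the following 22 graphs of order at most $6$: $K_1$, $\overline{K}_2$, $\overline{K}_3$, $\overline{K}_4$, $C_3$, $2K_2$, $P_4$, $C_4$, $C_3+e$, $K_4-e$, $K_4$, $P_2\cup P_3$, $S_{1,2}$, $P_5$, $C_3+e+e$, $C_3+2e$, $C_4+e$, $C_5$, $S_{2,2}$, $3K_2$, $K_{2,3}$, $K_{3,3}$. These 22 graphs are pairwise non-isomorphic, and none of them is isomorphic to a star $S_k$ with $k\ge 2$. -/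

import Mathlib

universe u v

namespace CoalitionGraph

/-- `D` is a connected dominating set of `G`: every vertex outside `D` has a neighbour in `D`,
and the subgraph induced by `D` is connected (in particular nonempty). -/
def IsConnectedDominating {V : Type v} (G : SimpleGraph V) (D : Set V) : Prop :=
  (∀ x, x ∉ D → ∃ y ∈ D, G.Adj x y) ∧ (G.induce D).Connected

/-- Two disjoint vertex sets form a connected coalition if neither is a connected dominating set
but their union is. -/
def FormCoalition {V : Type v} (G : SimpleGraph V) (A B : Set V) : Prop :=
  Disjoint A B ∧ ¬ IsConnectedDominating G A ∧ ¬ IsConnectedDominating G B ∧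
    IsConnectedDominating G (A ∪ B)

/-- A connected coalition partition: a partition of the vertex set into nonempty sets, each of
which is a one-vertex connected dominating set or forms a connected coalition with another one. -/
structure IsCoalitionPartition {V : Type v} (G : SimpleGraph V) (P : Set (Set V)) : Prop where
  isPartition : Setoid.IsPartition P
  single_or_coalition : ∀ A ∈ P,
    (IsConnectedDominating G A ∧ ∃ x, A = {x}) ∨ ∃ B ∈ P, FormCoalition G A B

/-- The coalition graph of `G` and `P`: its vertices are the members of `P`, and two of them are
adjacent when they form a connected coalition. -/
def coalitionGraph {V : Type v} (G : SimpleGraph V) (P : Set (Set V)) : SimpleGraph P where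
  Adj A B := FormCoalition G A.1 B.1
  symm := ⟨fun _ _ h => ⟨h.1.symm, h.2.2.1, h.2.1, by rw [Set.union_comm]; exact h.2.2.2⟩⟩
  loopless := ⟨fun _ h => h.2.1 (by simpa using h.2.2.2)⟩

/-- A graph is subcubic if it is connected with all vertex degrees at most `3`. -/
def IsSubcubic {V : Type v} (G : SimpleGraph V) : Prop :=
  G.Connected ∧ ∀ x, (G.neighborSet x).encard ≤ 3

/-- `H` is, up to isomorphism, the coalition graph of some connected coalition partition of some
finite subcubic graph. -/
def IsSubcubicCoalitionGraph {W : Type u} (H : SimpleGraph W) : Prop :=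
  ∃ (V : Type v) (_ : Finite V) (G : SimpleGraph V) (P : Set (Set V)),
    IsSubcubic G ∧ IsCoalitionPartition G P ∧ Nonempty (H ≃g coalitionGraph G P)

/-- The star `S_k` of order `k`. -/
def star : (k : ℕ) → SimpleGraph (Fin k)
  | 0 => ⊥
  | k + 1 => SimpleGraph.starGraph (0 : Fin (k + 1))

/-- The disjoint union, on the vertices `0, …, m + n - 1`. -/
def disjUnion {m n : ℕ} (G : SimpleGraph (Fin m)) (H : SimpleGraph (Fin n)) :
    SimpleGraph (Fin (m + n)) :=
  (G.sum H).comap finSumFinEquiv.symm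

/-- The complete bipartite graph `K_{p,q}`, on the vertices `0, …, p + q - 1`. -/
def completeBipartite (p q : ℕ) : SimpleGraph (Fin (p + q)) :=
  (completeBipartiteGraph (Fin p) (Fin q)).comap finSumFinEquiv.symm

/-- A triangle with a pendant edge. -/
def triangleE : SimpleGraph (Fin 4) :=
  SimpleGraph.fromEdgeSet {s(0, 1), s(1, 2), s(0, 2), s(0, 3)}

/-- A triangle with two pendant edges at different vertices. -/
def triangleEE : SimpleGraph (Fin 5) :=
  SimpleGraph.fromEdgeSet {s(0, 1), s(1, 2), s(0, 2), s(0, 3), s(1, 4)}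

/-- A triangle with two pendant edges at the same vertex. -/
def triangle2E : SimpleGraph (Fin 5) :=
  SimpleGraph.fromEdgeSet {s(0, 1), s(1, 2), s(0, 2), s(0, 3), s(0, 4)}

/-- A 4-cycle with a pendant edge. -/
def squareE : SimpleGraph (Fin 5) :=
  SimpleGraph.fromEdgeSet {s(0, 1), s(1, 2), s(2, 3), s(0, 3), s(0, 4)}

/-- The double star with adjacent centres `0`, `1` that carry one and two leaves. -/
def doubleStar12 : SimpleGraph (Fin 5) :=
  SimpleGraph.fromEdgeSet {s(0, 1), s(0, 2), s(1, 3), s(1, 4)}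

/-- The double star with adjacent centres `0`, `1` that carry two leaves each. -/
def doubleStar22 : SimpleGraph (Fin 6) :=
  SimpleGraph.fromEdgeSet {s(0, 1), s(0, 2), s(0, 3), s(1, 4), s(1, 5)}

/-- The list of the coalition graphs that are not stars: `K₁`, the complements of `K₂`, `K₃`, `K₄`,
`C₃`, `2K₂`, `P₄`, `C₄`, `C₃+e`, `K₄-e`, `K₄`, `P₂ ∪ P₃`, `S_{1,2}`, `P₅`, `C₃+e+e`, `C₃+2e`,
`C₄+e`, `C₅`, `S_{2,2}`, `3K₂`, `K_{2,3}`, `K_{3,3}`. -/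
def sporadic : List ((n : ℕ) × SimpleGraph (Fin n)) :=
  [⟨1, SimpleGraph.completeGraph (Fin 1)⟩,
   ⟨2, (SimpleGraph.completeGraph (Fin 2))ᶜ⟩,
   ⟨3, (SimpleGraph.completeGraph (Fin 3))ᶜ⟩,
   ⟨4, (SimpleGraph.completeGraph (Fin 4))ᶜ⟩,
   ⟨3, SimpleGraph.cycleGraph 3⟩,
   ⟨4, disjUnion (SimpleGraph.completeGraph (Fin 2)) (SimpleGraph.completeGraph (Fin 2))⟩,
   ⟨4, SimpleGraph.pathGraph 4⟩,
   ⟨4, SimpleGraph.cycleGraph 4⟩,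
   ⟨4, triangleE⟩,
   ⟨4, (SimpleGraph.completeGraph (Fin 4)).deleteEdges {s(0, 1)}⟩,
   ⟨4, SimpleGraph.completeGraph (Fin 4)⟩,
   ⟨5, disjUnion (SimpleGraph.pathGraph 2) (SimpleGraph.pathGraph 3)⟩,
   ⟨5, doubleStar12⟩,
   ⟨5, SimpleGraph.pathGraph 5⟩,
   ⟨5, triangleEE⟩,
   ⟨5, triangle2E⟩,
   ⟨5, squareE⟩,
   ⟨5, SimpleGraph.cycleGraph 5⟩,
   ⟨6, doubleStar22⟩,
   ⟨6, disjUnion (disjUnion (SimpleGraph.completeGraph (Fin 2))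
      (SimpleGraph.completeGraph (Fin 2))) (SimpleGraph.completeGraph (Fin 2))⟩,
   ⟨5, completeBipartite 2 3⟩,
   ⟨6, completeBipartite 3 3⟩]

end CoalitionGraph

/-! Let `D` be a connected dominating set of a subcubic graph on `n` vertices. The degrees in `D`
sum to at most `3|D|`. Connectivity uses at least `2(|D| - 1)` of this sum inside `D`, and each
vertex outside uses at least one more, so `n ≤ 2|D| + 2` (`IsConnectedDominating.card_le`). Equality
forces all degrees in `D` to be three and every outside vertex to have exactly one neighbour in `D`
(`IsConnectedDominating.tight`).

If some class is a dominating vertex, then `n ≤ 4` and the coalition graph `H` has no edges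
(`not_adj_of_dominating_vertex`). Otherwise `H` has no isolated vertex. Without two disjoint edges,
`H` is a star or a triangle (`star_or_triangle`). With two disjoint edges, adding the two
inequalities leaves at most two vertices of `G` outside the four classes, so `H` has order 4, 5 or
6.

In order 4 every graph with a perfect matching is on the list. In order 5 two local obstructions,
`no_triangle_and_edge` and `no_dart`, leave only listed graphs. In order 6 all estimates are sharp.
If `n = 6`, all classes are singletons, `G` is cubic and `H` consists of its dominating edges, which
gives `3K₂` or `K_{3,3}`. If `n ≥ 7`, two classes have two neighbours each, and `H` is the double
star `S_{2,2}` (`TwoCherries.iso`).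

Conversely, two paths joined by subdivided rungs realize the stars, and explicit coloured graphs,
verified by a sound checker, realize the sporadic graphs. Degree sequences separate the graphs of
the list from each other and from the stars. -/

namespace CoalitionGraph

open Finset

/-! ### Connected dominating sets and cuts. -/

section Basics

variable {V : Type v} {G : SimpleGraph V}

/-- Connectivity of an induced subgraph, in terms of cuts. -/
theorem induce_connected_iff (D : Set V) :
    (G.induce D).Connected ↔ D.Nonempty ∧
      ∀ S, S ⊆ D → S.Nonempty → S ≠ D → ∃ x ∈ S, ∃ y ∈ D, y ∉ S ∧ G.Adj x y := by
  constructor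
  · intro h
    refine ⟨Set.nonempty_coe_sort.1 h.nonempty, fun S hS hne hSD => ?_⟩
    by_contra! hcon
    obtain ⟨s, hs⟩ := hne
    obtain ⟨t, htD, htS⟩ : ∃ t ∈ D, t ∉ S := by
      by_contra! hc
      exact hSD (hS.antisymm hc)
    obtain ⟨p⟩ := h.preconnected ⟨s, hS hs⟩ ⟨t, htD⟩
    have key : ∀ (a b : D), (G.induce D).Walk a b → a.1 ∈ S → b.1 ∈ S := by
      intro a b p
      induction p with
      | nil => exact id
      | cons hadj _ ih =>
        intro ha
        refine ih ?_
        by_contra hb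
        exact hcon _ ha _ (Subtype.property _) hb hadj
    exact htS (key _ _ p hs)
  · rintro ⟨⟨d, hd⟩, hcut⟩
    rw [SimpleGraph.connected_iff_exists_forall_reachable]
    refine ⟨⟨d, hd⟩, ?_⟩
    set S : Set V := {x | ∃ hx : x ∈ D, (G.induce D).Reachable ⟨d, hd⟩ ⟨x, hx⟩} with hS
    have hSD : S = D := by
      by_contra hne
      obtain ⟨x, ⟨hxD, hx⟩, y, hyD, hyS, hxy⟩ :=
        hcut S (fun x hx => hx.1) ⟨d, hd, SimpleGraph.Reachable.refl _⟩ hne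
      refine hyS ⟨hyD, hx.trans ?_⟩
      exact SimpleGraph.Adj.reachable (G := G.induce D) (u := ⟨x, hxD⟩) (v := ⟨y, hyD⟩) hxy
    rintro ⟨w, hw⟩
    have : w ∈ S := hSD ▸ hw
    exact this.2

theorem IsConnectedDominating.nonempty {D : Set V} (h : IsConnectedDominating G D) :
    D.Nonempty := ((induce_connected_iff D).1 h.2).1

theorem IsConnectedDominating.cut {D S : Set V} (h : IsConnectedDominating G D) (hS : S ⊆ D)
    (hne : S.Nonempty) (hSD : S ≠ D) : ∃ x ∈ S, ∃ y ∈ D, y ∉ S ∧ G.Adj x y :=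
  ((induce_connected_iff D).1 h.2).2 S hS hne hSD

theorem IsConnectedDominating.exists_adj_of_ne {D : Set V} (h : IsConnectedDominating G D)
    {x y : V} (hx : x ∈ D) (hy : y ∈ D) (hxy : y ≠ x) : ∃ z ∈ D, G.Adj x z := by
  obtain ⟨_, rfl, z, hz, -, h'⟩ := h.cut (S := {x}) (by simpa using hx) ⟨x, rfl⟩
    (by rintro rfl; exact hxy hy)
  exact ⟨z, hz, h'⟩

/-- Every vertex has a neighbour in a connected dominating set of at least two vertices. -/
theorem IsConnectedDominating.exists_adj {D : Set V} (h : IsConnectedDominating G D)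
    {a b : V} (ha : a ∈ D) (hb : b ∈ D) (hab : a ≠ b) (x : V) : ∃ z ∈ D, G.Adj x z := by
  by_cases hx : x ∈ D
  · by_cases hxa : x = a
    · exact h.exists_adj_of_ne hx hb (by rw [hxa]; exact hab.symm)
    · exact h.exists_adj_of_ne hx ha (Ne.symm hxa)
  · exact h.1 x hx

theorem IsSubcubic.not_four (hG : IsSubcubic G) {x a b c d : V} (ha : G.Adj x a)
    (hb : G.Adj x b) (hc : G.Adj x c) (hd : G.Adj x d) (hab : a ≠ b) (hac : a ≠ c)
    (had : a ≠ d) (hbc : b ≠ c) (hbd : b ≠ d) (hcd : c ≠ d) : False := by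
  classical
  have h1 : ((({a, b, c, d} : Finset V) : Set V)) ⊆ G.neighborSet x := by
    intro y hy
    simp only [coe_insert, coe_singleton, Set.mem_insert_iff, Set.mem_singleton_iff] at hy
    rcases hy with rfl | rfl | rfl | rfl <;> assumption
  have h2 := (Set.encard_le_encard h1).trans (hG.2 x)
  rw [Set.encard_coe_eq_coe_finsetCard] at h2
  have h3 : #({a, b, c, d} : Finset V) = 4 := by
    rw [card_insert_of_notMem, card_insert_of_notMem, card_insert_of_notMem, card_singleton] <;>
      simp [*]
  rw [h3] at h2
  exact absurd h2 (by norm_num)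

/-- Removing leaves keeps an induced subgraph connected. -/
theorem connected_of_leaves {D L : Set V} (h : (G.induce (D ∪ L)).Connected) (hD : D.Nonempty)
    (hDL : Disjoint D L)
    (leaf : ∀ l ∈ L, ∀ x ∈ D ∪ L, ∀ y ∈ D ∪ L, G.Adj l x → G.Adj l y → x = y) :
    (G.induce D).Connected := by
  refine (induce_connected_iff _).2 ⟨hD, fun S hS hne hSD => ?_⟩
  by_contra! hcon
  -- If no edge of `D` leaves `S`, then adding to `S` the leaves attached to it gives a set that no
  -- edge of `D ∪ L` leaves.
  obtain ⟨s, hs, t, ht, hts, hst⟩ := ((induce_connected_iff _).1 h).2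
    (S ∪ {l | l ∈ L ∧ ∃ x ∈ S, G.Adj l x}) (by
      rintro x (hx | ⟨hx, -⟩)
      exacts [Or.inl (hS hx), Or.inr hx]) (hne.mono Set.subset_union_left) (by
      intro heq
      refine hSD (hS.antisymm fun x hx => ?_)
      have : x ∈ D ∪ L := Or.inl hx
      rw [← heq] at this
      rcases this with h' | ⟨h', -⟩
      · exact h'
      · exact absurd h' (Set.disjoint_left.1 hDL hx))
  rcases hs with hs | ⟨hs, x, hx, hsx⟩
  · rcases ht with ht | ht
    · exact hcon s hs t ht (fun h' => hts (Or.inl h')) hst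
    · exact hts (Or.inr ⟨ht, s, hs, hst.symm⟩)
  · have := leaf s hs x (Or.inl (hS hx)) t ht hsx hst
    exact hts (Or.inl (this ▸ hx))

end Basics

/-! ### Edge counting in subcubic graphs. -/

section Counting

variable {V : Type v} {G : SimpleGraph V}

open Classical in
/-- The number of neighbours of `x` in `S`. -/
noncomputable def degIn (G : SimpleGraph V) (x : V) (S : Finset V) : ℕ := #{y ∈ S | G.Adj x y}

theorem degIn_disjUnion [DecidableEq V] (x : V) {S T : Finset V} (h : Disjoint S T) :
    degIn G x (S ∪ T) = degIn G x S + degIn G x T := by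
  classical
  unfold degIn
  rw [filter_union, card_union_of_disjoint (disjoint_filter_filter h)]

theorem degIn_pos {x y : V} {S : Finset V} (hy : y ∈ S) (h : G.Adj x y) : 1 ≤ degIn G x S := by
  classical
  exact card_pos.2 ⟨y, by simp [hy, h]⟩

theorem degIn_le_three (hG : IsSubcubic G) (x : V) (S : Finset V) : degIn G x S ≤ 3 := by
  classical
  have h1 : (((S.filter (fun y => G.Adj x y) : Finset V) : Set V)) ⊆ G.neighborSet x := by
    intro y hy
    simp at hy
    exact hy.2
  have h2 := (Set.encard_le_encard h1).trans (hG.2 x)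
  rw [Set.encard_coe_eq_coe_finsetCard] at h2
  exact_mod_cast h2

theorem sum_degIn_comm (S T : Finset V) :
    ∑ x ∈ S, degIn G x T = ∑ y ∈ T, degIn G y S := by
  classical
  simp only [degIn, card_filter]
  rw [sum_comm]
  simp only [G.adj_comm]

theorem sum_degIn_union [DecidableEq V] (A : Finset V) {S T : Finset V} (h : Disjoint S T) :
    ∑ x ∈ A, degIn G x (S ∪ T) = ∑ x ∈ A, degIn G x S + ∑ x ∈ A, degIn G x T := by
  rw [← sum_add_distrib]
  exact sum_congr rfl fun x _ => degIn_disjUnion x h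

/-- If `A ∪ B` induces a connected graph, at least `|A|` of its edges meet `A`. -/
theorem card_le_of_connected [DecidableEq V] (A B : Finset V) (hB : B.Nonempty)
    (hAB : Disjoint A B) (h : (G.induce ((A ∪ B : Finset V) : Set V)).Connected) :
    2 * #A ≤ ∑ x ∈ A, degIn G x A + 2 * ∑ x ∈ A, degIn G x B := by
  induction hn : #A generalizing A B with
  | zero => simp
  | succ n ih =>
    have hA : A.Nonempty := card_pos.1 (by omega)
    -- The induction moves a vertex `a` of `A` that is adjacent to `B` over to `B`; at least one
    -- edge from `a` to `B` pays for it.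
    obtain ⟨b, hb, a, ha, haB, hadj⟩ := ((induce_connected_iff _).1 h).2 (B : Set V)
      (by simp) (by simpa using hB) (by
        intro heq
        obtain ⟨a, ha⟩ := hA
        have : a ∈ (B : Set V) := by rw [heq]; simp [ha]
        exact (disjoint_left.1 hAB ha) (by simpa using this))
    have haA : a ∈ A := by
      have : a ∈ A ∪ B := by simpa using ha
      rcases mem_union.1 this with h | h
      · exact h
      · exact absurd (by simpa using h) haB
    obtain ⟨A', haA', rfl⟩ : ∃ A', a ∉ A' ∧ A = insert a A' :=
      ⟨A.erase a, by simp, (insert_erase haA).symm⟩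
    have haB' : a ∉ B := by simpa using haB
    have hA'B : Disjoint A' B := by
      rw [disjoint_insert_left] at hAB; exact hAB.2
    have hd1 : Disjoint ({a} : Finset V) A' := by simpa using haA'
    have hd2 : Disjoint ({a} : Finset V) B := by simpa using haB'
    have key := ih A' ({a} ∪ B) (by simp) (by
        rw [disjoint_union_right]; exact ⟨hd1.symm, hA'B⟩)
      (by
        have : A' ∪ ({a} ∪ B) = insert a A' ∪ B := by
          ext x; simp only [mem_union, mem_singleton, mem_insert]; tauto
        rwa [this]) (by rw [card_insert_of_notMem haA'] at hn; omega)
    rw [sum_degIn_union _ hd2] at key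
    rw [insert_eq, sum_degIn_union _ hd1, sum_union hd1, sum_union hd1, sum_union hd1]
    have h1 : ∑ x ∈ A', degIn G x {a} = ∑ x ∈ {a}, degIn G x A' := sum_degIn_comm _ _
    have h2 : 1 ≤ degIn G a B := degIn_pos (by simpa using hb) hadj.symm
    simp only [sum_singleton] at *
    omega

/-- A connected graph has at least as many edges as a spanning tree; the degree sum counts each edge
twice. -/
theorem tree_bound [DecidableEq V] {D : Finset V} (h : (G.induce (D : Set V)).Connected) :
    2 * #D ≤ ∑ x ∈ D, degIn G x D + 2 := by
  obtain ⟨d, hd⟩ := ((induce_connected_iff _).1 h).1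
  obtain ⟨A, hdA, rfl⟩ : ∃ A, d ∉ A ∧ D = insert d A :=
    ⟨D.erase d, by simp, (insert_erase (by simpa using hd)).symm⟩
  have hdis : Disjoint A {d} := by simpa using hdA
  have key := card_le_of_connected A {d} (by simp) hdis (by
    rwa [union_comm, ← insert_eq])
  rw [card_insert_of_notMem hdA, insert_eq, union_comm, sum_degIn_union _ hdis, sum_union hdis,
    sum_union hdis, sum_degIn_comm {d} A]
  omega

theorem IsConnectedDominating.one_le_degIn {D : Finset V}
    (h : IsConnectedDominating G (D : Set V)) {y : V} (hy : y ∉ D) : 1 ≤ degIn G y D := by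
  obtain ⟨z, hz, hyz⟩ := h.1 y (by simpa using hy)
  exact degIn_pos (by simpa using hz) hyz

variable [Fintype V]

/-- The degree sum over `D` splits into edges inside `D`, bounded by `tree_bound`, and edges leaving
`D`, counted from their outer ends. -/
theorem IsConnectedDominating.count [DecidableEq V] {D : Finset V}
    (h : IsConnectedDominating G (D : Set V)) :
    ∑ x ∈ D, degIn G x univ + 2 ≥ 2 * #D + ∑ y ∈ Dᶜ, degIn G y D := by
  have h1 := tree_bound h.2
  have h2 : ∑ x ∈ D, degIn G x univ = ∑ x ∈ D, degIn G x D + ∑ x ∈ D, degIn G x Dᶜ := by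
    rw [← sum_degIn_union _ disjoint_compl_right, union_compl]
  rw [h2, sum_degIn_comm D Dᶜ]
  omega

theorem IsConnectedDominating.card_le_finset (hG : IsSubcubic G) {D : Finset V}
    (h : IsConnectedDominating G (D : Set V)) : Fintype.card V ≤ 2 * #D + 2 := by
  classical
  have h1 := h.count
  have h2 : ∑ x ∈ D, degIn G x univ ≤ #D * 3 :=
    sum_le_card_nsmul _ _ _ fun x _ => degIn_le_three hG x _
  have h3 : #Dᶜ * 1 ≤ ∑ y ∈ Dᶜ, degIn G y D :=
    card_nsmul_le_sum _ _ _ fun y hy => h.one_le_degIn (by simpa using hy)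
  rw [card_compl] at h3
  omega

theorem IsConnectedDominating.tight_finset (hG : IsSubcubic G) {D : Finset V}
    (h : IsConnectedDominating G (D : Set V)) (hn : Fintype.card V = 2 * #D + 2) :
    (∀ x ∈ D, degIn G x univ = 3) ∧ ∀ y ∉ D, degIn G y D = 1 := by
  classical
  have h1 := h.count
  have h2 : ∀ x ∈ D, degIn G x univ ≤ 3 := fun x _ => degIn_le_three hG x _
  have h3 : ∀ y ∈ Dᶜ, 1 ≤ degIn G y D := fun y hy => h.one_le_degIn (by simpa using hy)
  have h4 := sum_le_sum h2
  have h5 := sum_le_sum h3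
  have h6 : #D + #Dᶜ = Fintype.card V := card_add_card_compl D
  simp only [sum_const, smul_eq_mul] at h4 h5
  constructor
  · intro x hx
    exact (sum_eq_sum_iff_of_le h2).1 (by simp only [sum_const, smul_eq_mul]; omega) x hx
  · intro y hy
    exact ((sum_eq_sum_iff_of_le h3).1 (by simp only [sum_const, smul_eq_mul]; omega) y
      (by simpa using hy)).symm

theorem IsConnectedDominating.card_le (hG : IsSubcubic G) {D : Set V}
    (h : IsConnectedDominating G D) : Fintype.card V ≤ 2 * D.ncard + 2 := by
  classical
  have := IsConnectedDominating.card_le_finset (D := D.toFinset) hG (by simpa using h)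
  rwa [← Set.ncard_eq_toFinset_card'] at this

/-- In a connected dominating set of the least possible size all degrees are `3`, and the
neighbour in it of a vertex outside is unique. -/
theorem IsConnectedDominating.tight (hG : IsSubcubic G) {D : Set V}
    (h : IsConnectedDominating G D) (hn : Fintype.card V = 2 * D.ncard + 2) :
    (∀ x ∈ D, ∃ a b c, a ≠ b ∧ a ≠ c ∧ b ≠ c ∧ ∀ z, G.Adj x z ↔ z = a ∨ z = b ∨ z = c) ∧
      ∀ y ∉ D, ∃! z, z ∈ D ∧ G.Adj y z := by
  classical
  obtain ⟨h1, h2⟩ := IsConnectedDominating.tight_finset (D := D.toFinset) hG (by simpa using h)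
    (by rwa [← Set.ncard_eq_toFinset_card'])
  constructor
  · intro x hx
    obtain ⟨a, b, c, hab, hac, hbc, habc⟩ := card_eq_three.1 (h1 x (by simpa using hx))
    refine ⟨a, b, c, hab, hac, hbc, fun z => ?_⟩
    have : z ∈ ({y ∈ univ | G.Adj x y} : Finset V) ↔ z ∈ ({a, b, c} : Finset V) := by rw [habc]
    simpa using this
  · intro y hy
    obtain ⟨z, hz⟩ := card_eq_one.1 (h2 y (by simpa using hy))
    have key : ∀ w, w ∈ D ∧ G.Adj y w ↔ w = z := by
      intro w
      have : w ∈ ({t ∈ D.toFinset | G.Adj y t} : Finset V) ↔ w ∈ ({z} : Finset V) := by rw [hz]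
      simpa using this
    exact ⟨z, (key z).2 rfl, fun w hw => (key w).1 hw⟩

/-- If `A` is joined to connected sets through `B` and through `B'`, and every vertex of `A` has a
neighbour in `C`, then `A` has no further neighbours. -/
theorem no_adj_outside (hG : IsSubcubic G) {A B B' C : Set V} (hAB : Disjoint A B)
    (hAB' : Disjoint A B') (hBB' : Disjoint B B') (hAC : Disjoint A C) (hBC : Disjoint B C)
    (hBC' : Disjoint B' C) (hB : B.Nonempty) (hB' : B'.Nonempty)
    (h1 : (G.induce (A ∪ B)).Connected) (h2 : (G.induce (A ∪ B')).Connected)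
    (hC : ∀ x ∈ A, ∃ y ∈ C, G.Adj x y) {y l : V} (hy : y ∈ A) (hl : l ∉ A ∪ B ∪ B' ∪ C) :
    ¬ G.Adj y l := by
  classical
  intro hyl
  have k1 := card_le_of_connected (G := G) A.toFinset B.toFinset (by simpa using hB) (by simpa using hAB)
    (by rw [coe_union, Set.coe_toFinset, Set.coe_toFinset]; exact h1)
  have k2 := card_le_of_connected (G := G) A.toFinset B'.toFinset (by simpa using hB') (by simpa using hAB')
    (by rw [coe_union, Set.coe_toFinset, Set.coe_toFinset]; exact h2)
  set a := A.toFinset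
  set b := B.toFinset
  set b' := B'.toFinset
  set c := C.toFinset
  have ab : Disjoint a b := by simpa [a, b] using hAB
  have ab' : Disjoint a b' := by simpa [a, b'] using hAB'
  have bb' : Disjoint b b' := by simpa [b, b'] using hBB'
  have abb' : Disjoint (a ∪ b) b' := disjoint_union_left.2 ⟨ab', bb'⟩
  have abc : Disjoint (a ∪ b ∪ b') c := by
    simp only [disjoint_union_left]
    exact ⟨⟨by simpa [a, c] using hAC, by simpa [b, c] using hBC⟩, by simpa [b', c] using hBC'⟩
  have hl' : Disjoint (a ∪ b ∪ b' ∪ c) {l} := by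
    simp only [disjoint_singleton_right]
    simpa [a, b, b', c, not_or, and_assoc] using hl
  -- One of the three possible edges at `x` goes to `C`. The sum of `k1` and `k2` says that the
  -- average of this left-hand side over `A` is at least two, so no vertex of `A` can have less than
  -- two.
  have hle : ∀ x ∈ a, degIn G x a + degIn G x b + degIn G x b' ≤ 2 := by
    intro x hx
    obtain ⟨z, hz, hxz⟩ := hC x (by simpa [a] using hx)
    have := degIn_pos (S := c) (by simpa [c] using hz) hxz
    have h3 := degIn_le_three hG x (a ∪ b ∪ b' ∪ c)
    rw [degIn_disjUnion _ abc, degIn_disjUnion _ abb', degIn_disjUnion _ ab] at h3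
    omega
  have hlt : degIn G y a + degIn G y b + degIn G y b' < 2 := by
    obtain ⟨z, hz, hxz⟩ := hC y hy
    have := degIn_pos (S := c) (by simpa [c] using hz) hxz
    have h3 := degIn_le_three hG y (a ∪ b ∪ b' ∪ c ∪ {l})
    have h4 := degIn_pos (S := {l}) (by simp) hyl
    rw [degIn_disjUnion _ hl', degIn_disjUnion _ abc, degIn_disjUnion _ abb',
      degIn_disjUnion _ ab] at h3
    omega
  have hs := sum_lt_sum hle ⟨y, by simpa [a] using hy, hlt⟩
  simp only [sum_add_distrib, sum_const, smul_eq_mul] at hs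
  omega

end Counting

/-! ### Coalition partitions indexed by the vertices of the coalition graph. -/

/-- The sets `cl i` partition the vertices of `G` into a connected coalition partition whose
coalition graph is `H`. -/
structure Realizes {V : Type v} {W : Type u} (G : SimpleGraph V) (cl : W → Set V)
    (H : SimpleGraph W) : Prop where
  nonempty : ∀ i, (cl i).Nonempty
  disjoint : ∀ i j, i ≠ j → Disjoint (cl i) (cl j)
  cover : ∀ x, ∃ i, x ∈ cl i
  adj_iff : ∀ i j, H.Adj i j ↔ FormCoalition G (cl i) (cl j)
  single_or_adj : ∀ i, (IsConnectedDominating G (cl i) ∧ ∃ x, cl i = {x}) ∨ ∃ j, H.Adj i j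

theorem isSubcubicCoalitionGraph_iff {W : Type u} {H : SimpleGraph W} :
    IsSubcubicCoalitionGraph.{u, v} H ↔
      ∃ (V : Type v) (_ : Finite V) (G : SimpleGraph V) (cl : W → Set V),
        IsSubcubic G ∧ Realizes G cl H := by
  constructor
  · rintro ⟨V, hV, G, P, hG, hP, ⟨e⟩⟩
    refine ⟨V, hV, G, fun i => (e i).1, hG, ?_, ?_, ?_, ?_, ?_⟩
    · exact fun i => Setoid.nonempty_of_mem_partition hP.isPartition (e i).2
    · intro i j hij
      exact hP.isPartition.pairwiseDisjoint (e i).2 (e j).2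
        (fun h => hij (e.injective (Subtype.ext h)))
    · intro x
      obtain ⟨b, ⟨hb, hx⟩, -⟩ := hP.isPartition.2 x
      exact ⟨e.symm ⟨b, hb⟩, by simpa using hx⟩
    · exact fun i j => (e.map_adj_iff (v := i) (w := j)).symm
    · intro i
      rcases hP.single_or_coalition _ (e i).2 with h | ⟨B, hB, h⟩
      · exact Or.inl h
      · have h' : (e (e.symm ⟨B, hB⟩)).1 = B := by rw [RelIso.apply_symm_apply]
        refine Or.inr ⟨e.symm ⟨B, hB⟩, e.map_adj_iff.1 ?_⟩
        change FormCoalition G (e i).1 (e (e.symm ⟨B, hB⟩)).1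
        rwa [h']
  · rintro ⟨V, hV, G, cl, hG, h⟩
    have hinj : Function.Injective cl := by
      intro i j hij
      by_contra hne
      have := h.disjoint i j hne
      rw [hij, disjoint_self] at this
      exact (h.nonempty j).ne_empty this
    refine ⟨V, hV, G, Set.range cl, hG, ⟨⟨?_, ?_⟩, ?_⟩, ⟨⟨Equiv.ofInjective cl hinj, ?_⟩⟩⟩
    · rintro ⟨i, hi⟩
      exact (h.nonempty i).ne_empty hi
    · intro x
      obtain ⟨i, hi⟩ := h.cover x
      refine ⟨cl i, ⟨⟨i, rfl⟩, hi⟩, ?_⟩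
      rintro _ ⟨⟨j, rfl⟩, hj⟩
      by_contra hne
      exact Set.disjoint_left.1 (h.disjoint j i (fun h' => hne (by rw [h']))) hj hi
    · rintro _ ⟨i, rfl⟩
      rcases h.single_or_adj i with h' | ⟨j, hj⟩
      · exact Or.inl h'
      · exact Or.inr ⟨cl j, ⟨j, rfl⟩, (h.adj_iff i j).1 hj⟩
    · intro i j
      exact (h.adj_iff i j).symm

namespace Realizes

variable {V : Type v} {W : Type u} {G : SimpleGraph V} {cl : W → Set V} {H : SimpleGraph W}

theorem ne_of_mem (h : Realizes G cl H) {i j : W} {x y : V} (hx : x ∈ cl i) (hy : y ∈ cl j)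
    (hij : i ≠ j) : x ≠ y := by
  rintro rfl
  exact Set.disjoint_left.1 (h.disjoint i j hij) hx hy

theorem notMem (h : Realizes G cl H) {i j : W} {x : V} (hx : x ∈ cl i) (hij : i ≠ j) :
    x ∉ cl j := fun hy => h.ne_of_mem hx hy hij rfl

theorem dominating (h : Realizes G cl H) {i j : W} (hij : H.Adj i j) :
    IsConnectedDominating G (cl i ∪ cl j) := ((h.adj_iff i j).1 hij).2.2.2

theorem not_dominating (h : Realizes G cl H) {i j : W} (hij : H.Adj i j) :
    ¬ IsConnectedDominating G (cl i) := ((h.adj_iff i j).1 hij).2.1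

theorem adj_of (h : Realizes G cl H) {i j i' j' : W} (hij : i ≠ j) (hi : H.Adj i i')
    (hj : H.Adj j j') (hd : IsConnectedDominating G (cl i ∪ cl j)) : H.Adj i j :=
  (h.adj_iff i j).2 ⟨h.disjoint i j hij, h.not_dominating hi, h.not_dominating hj, hd⟩

/-- Every vertex has a neighbour in the union of two adjacent classes. -/
theorem exists_nbr (h : Realizes G cl H) {i j : W} (hij : H.Adj i j) (x : V) :
    ∃ y, (y ∈ cl i ∨ y ∈ cl j) ∧ G.Adj x y := by
  obtain ⟨a, ha⟩ := h.nonempty i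
  obtain ⟨b, hb⟩ := h.nonempty j
  exact (h.dominating hij).exists_adj (Or.inl ha) (Or.inr hb) (h.ne_of_mem ha hb hij.ne) x

theorem map_iso {W' : Type*} (h : Realizes G cl H) {H' : SimpleGraph W'} (e : H' ≃g H) :
    Realizes G (cl ∘ e) H' where
  nonempty i := h.nonempty _
  disjoint i j hij := h.disjoint _ _ (fun h' => hij (e.injective h'))
  cover x := by
    obtain ⟨i, hi⟩ := h.cover x
    exact ⟨e.symm i, by simpa using hi⟩
  adj_iff i j := by rw [← e.map_adj_iff, h.adj_iff]; rfl
  single_or_adj i := by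
    rcases h.single_or_adj (e i) with h' | ⟨j, hj⟩
    · exact Or.inl h'
    · exact Or.inr ⟨e.symm j, by rw [← e.map_adj_iff]; simpa using hj⟩

section Card

variable [Fintype V]

theorem sum_ncard_le (h : Realizes G cl H) (s : Finset W) :
    ∑ i ∈ s, (cl i).ncard ≤ Fintype.card V := by
  classical
  have h1 : #(s.biUnion fun i => (cl i).toFinset) = ∑ i ∈ s, #(cl i).toFinset := by
    refine card_biUnion fun i _ j _ hij => ?_
    simpa using h.disjoint i j hij
  simp only [Set.ncard_eq_toFinset_card']
  rw [← h1]
  exact card_le_univ _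

theorem sum_ncard [Fintype W] (h : Realizes G cl H) :
    ∑ i, (cl i).ncard = Fintype.card V := by
  classical
  have h1 : #(univ.biUnion fun i => (cl i).toFinset) = ∑ i, #(cl i).toFinset := by
    refine card_biUnion fun i _ j _ hij => ?_
    simpa using h.disjoint i j hij
  simp only [Set.ncard_eq_toFinset_card']
  rw [← h1, ← card_univ]
  congr 1
  ext x
  simpa using h.cover x

theorem one_le_ncard (h : Realizes G cl H) (i : W) : 1 ≤ (cl i).ncard :=
  (Set.ncard_pos (Set.toFinite _)).2 (h.nonempty i)

theorem finite_index (h : Realizes G cl H) : Finite W := by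
  choose f hf using h.nonempty
  refine Finite.of_injective f fun i j hij => ?_
  by_contra hne
  exact h.ne_of_mem (hf i) (hf j) hne hij

theorem ncard_union (h : Realizes G cl H) {i j : W} (hij : i ≠ j) :
    (cl i ∪ cl j).ncard = (cl i).ncard + (cl j).ncard :=
  Set.ncard_union_eq (h.disjoint i j hij) (Set.toFinite _) (Set.toFinite _)

theorem card_le_of_adj (hG : IsSubcubic G) (h : Realizes G cl H) {i j : W} (hij : H.Adj i j) :
    Fintype.card V ≤ 2 * ((cl i).ncard + (cl j).ncard) + 2 := by
  rw [← h.ncard_union hij.ne]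
  exact (h.dominating hij).card_le hG

/-- Two disjoint edges of the coalition graph leave at most two vertices for other classes. -/
theorem sum_ncard_rest_le (hG : IsSubcubic G) (h : Realizes G cl H) {a b c d : W}
    (hab : H.Adj a b) (hcd : H.Adj c d) (hac : a ≠ c) (had : a ≠ d) (hbc : b ≠ c) (hbd : b ≠ d)
    (s : Finset W) (ha : a ∉ s) (hb : b ∉ s) (hc : c ∉ s) (hd : d ∉ s) :
    ∑ i ∈ s, (cl i).ncard ≤ 2 := by
  classical
  -- The sum of the two bounds is `n ≤ |a| + |b| + |c| + |d| + 2`, where `n` counts the four classes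
  -- and those in `s`.
  have h1 := h.card_le_of_adj hG hab
  have h2 := h.card_le_of_adj hG hcd
  have h3 := h.sum_ncard_le (insert a (insert b (insert c (insert d s))))
  rw [sum_insert (by simp [hab.ne, hac, had, ha]), sum_insert (by simp [hbc, hbd, hb]),
    sum_insert (by simp [hcd.ne, hc]), sum_insert hd] at h3
  omega

end Card


/-! ### Forbidden configurations in order five. -/

variable {V : Type v} {W : Type u} {G : SimpleGraph V} {cl : W → Set V} {H : SimpleGraph W}

/-- A triangle and a disjoint edge in a coalition graph of order five, where two classes of the
triangle and both classes of the edge are singletons. -/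
theorem false_of_triangle_of_singletons (hG : IsSubcubic G) (h : Realizes G cl H) {a b c d e : W}
    (hcov : ∀ i, i = a ∨ i = b ∨ i = c ∨ i = d ∨ i = e)
    (hab : H.Adj a b) (hac : H.Adj a c) (hbc : H.Adj b c) (hde : H.Adj d e)
    (had : a ≠ d) (hae : a ≠ e) (hbd : b ≠ d) (hbe : b ≠ e) (hcd : c ≠ d) (hce : c ≠ e)
    {y z p q : V} (hy : cl b = {y}) (hz : cl c = {z}) (hp : cl d = {p}) (hq : cl e = {q}) :
    False := by
  have my : y ∈ cl b := by simp [hy]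
  have mz : z ∈ cl c := by simp [hz]
  have mp : p ∈ cl d := by simp [hp]
  have mq : q ∈ cl e := by simp [hq]
  have nyz := h.ne_of_mem my mz hbc.ne
  have npq := h.ne_of_mem mp mq hde.ne
  have nyp := h.ne_of_mem my mp hbd
  have nyq := h.ne_of_mem my mq hbe
  have nzp := h.ne_of_mem mz mp hcd
  have nzq := h.ne_of_mem mz mq hce
  have na : ∀ {x}, x ∈ cl a → x ≠ y ∧ x ≠ z ∧ x ≠ p ∧ x ≠ q := fun hx =>
    ⟨h.ne_of_mem hx my hab.ne, h.ne_of_mem hx mz hac.ne, h.ne_of_mem hx mp had,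
      h.ne_of_mem hx mq hae⟩
  have two : ∀ {i j : W} {u v x : V}, H.Adj i j → cl i = {u} → cl j = {v} →
      G.Adj x u ∨ G.Adj x v := by
    intro i j u v x hij hu hv
    obtain ⟨w, hw, hxw⟩ := h.exists_nbr hij x
    rw [hu, hv] at hw
    rcases hw with rfl | rfl
    · exact Or.inl hxw
    · exact Or.inr hxw
  have one : ∀ {i : W} {u : V} (x : V), H.Adj a i → cl i = {u} →
      (∃ w ∈ cl a, G.Adj x w) ∨ G.Adj x u := by
    intro i u x hij hu
    obtain ⟨w, hw, hxw⟩ := h.exists_nbr hij x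
    rw [hu] at hw
    rcases hw with hw | rfl
    · exact Or.inl ⟨w, hw, hxw⟩
    · exact Or.inr hxw
  have ayz : G.Adj y z := (two hbc hy hz).resolve_left (G.loopless.irrefl y)
  have apq : G.Adj p q := (two hde hp hq).resolve_left (G.loopless.irrefl p)
  obtain ⟨w, hw, hyw⟩ := (one y hab hy).resolve_right (G.loopless.irrefl y)
  obtain ⟨w', hw', hzw'⟩ := (one z hac hz).resolve_right (G.loopless.irrefl z)
  -- If `p` had no neighbour in `cl a`, it would be adjacent to both `y` and `z`; as `q` is adjacent
  -- to one of them, that one would have degree four. Both members of the edge `d e` are handled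
  -- this way, which makes `cl a` dominating.
  have dom : ∀ {p q : V}, y ≠ p → y ≠ q → z ≠ p → z ≠ q → p ≠ q → (∀ {x}, x ∈ cl a → x ≠ p ∧ x ≠ q) →
      (G.Adj q y ∨ G.Adj q z) → ∃ u ∈ cl a, G.Adj p u := by
    intro p q nyp nyq nzp nzq npq na' hq
    by_contra hcon
    have py := (one p hab hy).resolve_left hcon
    have pz := (one p hac hz).resolve_left hcon
    rcases hq with hq | hq
    · exact hG.not_four ayz hyw py.symm hq.symm (na hw).2.1.symm nzp nzq (na' hw).1 (na' hw).2 npq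
    · exact hG.not_four ayz.symm hzw' pz.symm hq.symm (na hw').1.symm nyp nyq (na' hw').1
        (na' hw').2 npq
  refine h.not_dominating hab ⟨?_, (induce_connected_iff _).2 ⟨h.nonempty a, ?_⟩⟩
  · intro x hx
    obtain ⟨i, hi⟩ := h.cover x
    rcases hcov i with rfl | rfl | rfl | rfl | rfl
    · exact absurd hi hx
    · rw [hy] at hi
      obtain rfl := hi
      exact ⟨w, hw, hyw⟩
    · rw [hz] at hi
      obtain rfl := hi
      exact ⟨w', hw', hzw'⟩
    · rw [hp] at hi
      obtain rfl := hi
      exact dom nyp nyq nzp nzq npq (fun hx => (na hx).2.2) (two hbc hy hz)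
    · rw [hq] at hi
      obtain rfl := hi
      exact dom nyq nyp nzq nzp npq.symm (fun hx => (na hx).2.2.symm) (two hbc hy hz)
  · intro S hS hne hSa
    by_contra! hcon
    -- If `cl a` falls apart into `S` and its complement, a single vertex that makes it connected
    -- has neighbours in both parts. So `y` and `z` each have two neighbours in `cl a`, besides each
    -- other, and `p` is a fourth neighbour of one of them.
    have mk : ∀ {i : W} {u : V}, H.Adj a i → cl i = {u} →
        ∃ s ∈ cl a, ∃ t ∈ cl a, s ≠ t ∧ G.Adj u s ∧ G.Adj u t := by
      intro i u hi hu
      have hdis : ∀ x ∈ cl a, x ≠ u := fun x hx => h.ne_of_mem hx (by rw [hu]; rfl) hi.ne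
      have mem : ∀ {x}, x ∈ cl a ∪ cl i ↔ x ∈ cl a ∨ x = u := by
        intro x
        rw [hu]
        rfl
      obtain ⟨s, hs, t, ht, hts, hst⟩ := (h.dominating hi).cut (S := S)
        (hS.trans Set.subset_union_left) hne (by
          rintro rfl
          exact hdis u (hS (mem.2 (Or.inr rfl))) rfl)
      obtain ⟨s', hs', t', ht', hts', hst'⟩ := (h.dominating hi).cut (S := cl a \ S)
        (Set.sdiff_subset.trans Set.subset_union_left) (by
          by_contra hem
          rw [Set.not_nonempty_iff_eq_empty, Set.sdiff_eq_empty] at hem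
          exact hSa (hS.antisymm hem)) (by
          intro heq
          have : u ∈ cl a \ S := by
            rw [heq]
            exact mem.2 (Or.inr rfl)
          exact hdis u this.1 rfl)
      rcases mem.1 ht with ht | rfl
      · exact absurd hst (hcon s hs t ht hts)
      · rcases mem.1 ht' with ht' | rfl
        · have : t' ∈ S := by
            by_contra h'
            exact hts' ⟨ht', h'⟩
          exact absurd hst'.symm (hcon t' this s' hs'.1 hs'.2)
        · exact ⟨s, hS hs, s', hs'.1, fun h' => hs'.2 (h' ▸ hs), hst.symm, hst'.symm⟩
    obtain ⟨s, hs, t, ht, hst, ys, yt⟩ := mk hab hy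
    obtain ⟨s', hs', t', ht', hst', zs, zt⟩ := mk hac hz
    rcases two (x := p) hbc hy hz with hpy | hpz
    · exact hG.not_four ayz ys yt hpy.symm (na hs).2.1.symm (na ht).2.1.symm nzp hst (na hs).2.2.1
        (na ht).2.2.1
    · exact hG.not_four ayz.symm zs zt hpz.symm (na hs').1.symm (na ht').1.symm nyp hst'
        (na hs').2.2.1 (na ht').2.2.1

/-- No coalition graph of order five contains a triangle and a disjoint edge. -/
theorem no_triangle_and_edge [Fintype V] (hG : IsSubcubic G) (h : Realizes G cl H)
    {a b c d e : W}
    (hcov : ∀ i, i = a ∨ i = b ∨ i = c ∨ i = d ∨ i = e)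
    (hab : H.Adj a b) (hac : H.Adj a c) (hbc : H.Adj b c)
    (had : a ≠ d) (hae : a ≠ e) (hbd : b ≠ d) (hbe : b ≠ e) (hcd : c ≠ d) (hce : c ≠ e) :
    ¬ H.Adj d e := by
  classical
  intro hde
  -- The neighbours of `x` provided by the three edges of the triangle cannot all lie in one class.
  have outside : ∀ x, ∃ u v, u ≠ v ∧ u ∉ cl d ∪ cl e ∧ v ∉ cl d ∪ cl e ∧ G.Adj x u ∧
      G.Adj x v := by
    intro x
    have key : ∀ {i j : W} {y : V}, i ≠ j → i ≠ d → i ≠ e → j ≠ d → j ≠ e → y ∈ cl i →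
        G.Adj x y → (∃ w, w ∈ cl j ∧ G.Adj x w) → ∃ u v, u ≠ v ∧ u ∉ cl d ∪ cl e ∧
        v ∉ cl d ∪ cl e ∧ G.Adj x u ∧ G.Adj x v := by
      rintro i j y hij hid hie hjd hje hy hxy ⟨w, hw, hxw⟩
      refine ⟨y, w, h.ne_of_mem hy hw hij, ?_, ?_, hxy, hxw⟩
      · rintro (h' | h')
        · exact h.notMem hy hid h'
        · exact h.notMem hy hie h'
      · rintro (h' | h')
        · exact h.notMem hw hjd h'
        · exact h.notMem hw hje h'
    obtain ⟨s, hs, hxs⟩ := h.exists_nbr hab x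
    obtain ⟨t, ht, hxt⟩ := h.exists_nbr hac x
    obtain ⟨r, hr, hxr⟩ := h.exists_nbr hbc x
    rcases hs with hs | hs
    · rcases hr with hr | hr
      · exact key hab.ne had hae hbd hbe hs hxs ⟨r, hr, hxr⟩
      · exact key hac.ne had hae hcd hce hs hxs ⟨r, hr, hxr⟩
    · rcases ht with ht | ht
      · exact key hab.ne.symm hbd hbe had hae hs hxs ⟨t, ht, hxt⟩
      · exact key hbc.ne hbd hbe hcd hce hs hxs ⟨t, ht, hxt⟩
  have unique : ∀ {x y z}, y ∈ cl d ∪ cl e → z ∈ cl d ∪ cl e → G.Adj x y → G.Adj x z → y = z := by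
    intro x y z hy hz hxy hxz
    by_contra hne
    obtain ⟨u, v, huv, hu, hv, hxu, hxv⟩ := outside x
    have ne : ∀ {s t}, s ∈ cl d ∪ cl e → t ∉ cl d ∪ cl e → s ≠ t := by
      rintro s _ hs ht rfl
      exact ht hs
    exact hG.not_four hxy hxz hxu hxv hne (ne hy hu) (ne hy hv) (ne hz hu) (ne hz hv) huv
  obtain ⟨p, hp⟩ := h.nonempty d
  obtain ⟨q', hq'⟩ := h.nonempty e
  obtain ⟨q, hq, hpq⟩ := (h.dominating hde).exists_adj (Or.inl hp) (Or.inr hq')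
    (h.ne_of_mem hp hq' hde.ne) p
  -- By `unique`, the connected graph on `cl d ∪ cl e` has maximum degree one, so it is a single
  -- edge.
  have hQ : cl d ∪ cl e = {p, q} := by
    by_contra hne
    have hpD : p ∈ cl d ∪ cl e := Or.inl hp
    obtain ⟨s, hs, t, ht, hts, hst⟩ := (h.dominating hde).cut (S := {p, q})
      (by rintro x (rfl | rfl); exacts [hpD, hq]) ⟨p, by simp⟩ (Ne.symm hne)
    rcases hs with rfl | rfl
    · exact hts (by rw [unique ht hq hst hpq]; simp)
    · exact hts (by rw [unique ht hpD hst hpq.symm]; simp)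
  have hq'q : q' = q := by
    have : q' ∈ ({p, q} : Set V) := hQ ▸ Or.inr hq'
    rcases this with rfl | h'
    · exact absurd rfl (h.ne_of_mem hp hq' hde.ne)
    · exact h'
  subst hq'q
  have hd : cl d = {p} := by
    refine Set.Subset.antisymm (fun x hx => ?_) (by simpa using hp)
    have : x ∈ ({p, q'} : Set V) := hQ ▸ Or.inl hx
    rcases this with h' | rfl
    · exact h'
    · exact absurd hq' (h.notMem hx hde.ne)
  have he : cl e = {q'} := by
    refine Set.Subset.antisymm (fun x hx => ?_) (by simpa using hq')
    have : x ∈ ({p, q'} : Set V) := hQ ▸ Or.inr hx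
    rcases this with rfl | h'
    · exact absurd hx (h.notMem hp hde.ne)
    · exact h'
  -- Now `G` has at most six vertices, so `a`, `b`, `c` share at most four and two of them are
  -- singletons.
  have hn := h.card_le_of_adj hG hde
  rw [hd, he, Set.ncard_singleton, Set.ncard_singleton] at hn
  have hs := h.sum_ncard_le {a, b, c, d, e}
  rw [sum_insert (by simp [hab.ne, hac.ne, had, hae]), sum_insert (by simp [hbc.ne, hbd, hbe]),
    sum_insert (by simp [hcd, hce]), sum_insert (by simp [hde.ne]), sum_singleton, hd, he,
    Set.ncard_singleton, Set.ncard_singleton] at hs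
  have ha1 := h.one_le_ncard a
  have hb1 := h.one_le_ncard b
  have hc1 := h.one_le_ncard c
  have hcov1 : ∀ i, i = b ∨ i = a ∨ i = c ∨ i = d ∨ i = e := fun i => by
    rcases hcov i with h | h | h | h | h <;> simp [h]
  have hcov2 : ∀ i, i = c ∨ i = a ∨ i = b ∨ i = d ∨ i = e := fun i => by
    rcases hcov i with h | h | h | h | h <;> simp [h]
  have : ((cl b).ncard = 1 ∧ (cl c).ncard = 1) ∨ ((cl a).ncard = 1 ∧ (cl c).ncard = 1) ∨
      ((cl a).ncard = 1 ∧ (cl b).ncard = 1) := by omega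
  simp only [Set.ncard_eq_one] at this
  rcases this with ⟨⟨y, hy⟩, ⟨z, hz⟩⟩ | ⟨⟨y, hy⟩, ⟨z, hz⟩⟩ | ⟨⟨y, hy⟩, ⟨z, hz⟩⟩
  · exact h.false_of_triangle_of_singletons hG hcov hab hac hbc hde had hae hbd hbe hcd hce hy hz
      hd he
  · exact h.false_of_triangle_of_singletons hG hcov1 hab.symm hbc hac hde hbd hbe had hae hcd hce
      hy hz hd he
  · exact h.false_of_triangle_of_singletons hG hcov2 hac.symm hbc.symm hab hde hcd hce had hae hbd
      hbe hy hz hd he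

/-- No coalition graph of order five contains two triangles with a common edge `a b` and a fifth
class adjacent to `b`. -/
theorem no_dart [Fintype V] (hG : IsSubcubic G) (h : Realizes G cl H) {a b c d e : W}
    (hcov : ∀ i, i = a ∨ i = b ∨ i = c ∨ i = d ∨ i = e)
    (hab : H.Adj a b) (hac : H.Adj a c) (hbc : H.Adj b c) (had : H.Adj a d) (hbd : H.Adj b d)
    (hcd : c ≠ d) (hae : a ≠ e) (hce : c ≠ e) (hde : d ≠ e) : ¬ H.Adj b e := by
  intro hbe
  -- The goal is that `cl b` alone is connected and dominating. A vertex of `cl a` without neighbour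
  -- in `cl b` would have one in each of the four classes adjacent to `b`.
  have nbr_b : ∀ x ∈ cl a, ∃ y ∈ cl b, G.Adj x y := by
    intro x hx
    by_contra! hcon
    have get : ∀ {i}, H.Adj b i → ∃ y ∈ cl i, G.Adj x y := by
      intro i hi
      obtain ⟨y, hy | hy, hxy⟩ := h.exists_nbr hi x
      · exact absurd hxy (hcon y hy)
      · exact ⟨y, hy, hxy⟩
    obtain ⟨s, hs, xs⟩ := get hbc
    obtain ⟨t, ht, xt⟩ := get hbd
    obtain ⟨r, hr, xr⟩ := get hbe
    obtain ⟨q, hq, xq⟩ := get hab.symm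
    exact hG.not_four xs xt xr xq (h.ne_of_mem hs ht hcd) (h.ne_of_mem hs hr hce)
      (h.ne_of_mem hs hq hac.ne.symm) (h.ne_of_mem ht hr hde) (h.ne_of_mem ht hq had.ne.symm)
      (h.ne_of_mem hr hq hae.symm)
  have not_ae : ∀ y ∈ cl a, ∀ l ∈ cl e, ¬ G.Adj y l := by
    intro y hy l hl
    refine no_adj_outside hG (h.disjoint a c hac.ne) (h.disjoint a d had.ne) (h.disjoint c d hcd)
      (h.disjoint a b hab.ne) (h.disjoint c b hbc.ne.symm) (h.disjoint d b hbd.ne.symm)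
      (h.nonempty c) (h.nonempty d) (h.dominating hac).2 (h.dominating had).2 nbr_b hy ?_
    rintro (((h' | h') | h') | h')
    exacts [h.notMem hl hae.symm h', h.notMem hl hce.symm h', h.notMem hl hde.symm h',
      h.notMem hl hbe.ne.symm h']
  have e_nbrs : ∀ l ∈ cl e, ∃ s ∈ cl b, ∃ t ∈ cl c, ∃ r ∈ cl d, G.Adj l s ∧ G.Adj l t ∧
      G.Adj l r := by
    intro l hl
    have get : ∀ {i}, H.Adj a i → ∃ y ∈ cl i, G.Adj l y := by
      intro i hi
      obtain ⟨y, hy | hy, hxy⟩ := h.exists_nbr hi l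
      · exact absurd hxy.symm (not_ae y hy l hl)
      · exact ⟨y, hy, hxy⟩
    obtain ⟨s, hs, ls⟩ := get hab
    obtain ⟨t, ht, lt⟩ := get hac
    obtain ⟨r, hr, lr⟩ := get had
    exact ⟨s, hs, t, ht, r, hr, ls, lt, lr⟩
  -- A vertex of `cl e` spends two of its three edges on `cl c` and `cl d`, so it is a leaf of `cl b
  -- ∪ cl e`; the vertices of `cl e` can therefore be removed without disconnecting `cl b`.
  have leaf : ∀ l ∈ cl e, ∀ x ∈ cl b ∪ cl e, ∀ y ∈ cl b ∪ cl e, G.Adj l x → G.Adj l y → x = y := by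
    intro l hl x hx y hy lx ly
    by_contra hne
    obtain ⟨s, -, t, ht, r, hr, -, lt, lr⟩ := e_nbrs l hl
    have ne : ∀ {i z w}, z ∈ cl b ∪ cl e → w ∈ cl i → i ≠ b → i ≠ e → z ≠ w := by
      rintro i z w (hz | hz) hw hi hi'
      · exact h.ne_of_mem hz hw hi.symm
      · exact h.ne_of_mem hz hw hi'.symm
    exact hG.not_four lx ly lt lr hne (ne hx ht hbc.ne.symm hce) (ne hx hr hbd.ne.symm hde)
      (ne hy ht hbc.ne.symm hce) (ne hy hr hbd.ne.symm hde) (h.ne_of_mem ht hr hcd)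
  have third : ∀ {i j : W}, H.Adj a i → H.Adj b i →
      H.Adj a j → H.Adj b j → i ≠ j → i ≠ e → j ≠ e → ∀ x ∈ cl i, ∃ y ∈ cl b, G.Adj x y := by
    intro i j hai hbi haj hbj hij hie hje x hx
    by_contra! hcon
    have get : ∀ {k}, H.Adj b k → ∃ y ∈ cl k, G.Adj x y := by
      intro k hk
      obtain ⟨y, hy | hy, hxy⟩ := h.exists_nbr hk x
      · exact absurd hxy (hcon y hy)
      · exact ⟨y, hy, hxy⟩
    obtain ⟨s, hs, xs⟩ := get hab.symm
    obtain ⟨t, ht, xt⟩ := get hbi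
    obtain ⟨r, hr, xr⟩ := get hbj
    obtain ⟨q, hq, xq⟩ := get hbe
    exact hG.not_four xs xt xr xq (h.ne_of_mem hs ht hai.ne) (h.ne_of_mem hs hr haj.ne)
      (h.ne_of_mem hs hq hae) (h.ne_of_mem ht hr hij) (h.ne_of_mem ht hq hie)
      (h.ne_of_mem hr hq hje)
  refine h.not_dominating hbe ⟨?_,
    connected_of_leaves (h.dominating hbe).2 (h.nonempty b) (h.disjoint b e hbe.ne) leaf⟩
  · intro x hx
    obtain ⟨i, hi⟩ := h.cover x
    rcases hcov i with rfl | rfl | rfl | rfl | rfl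
    · exact nbr_b x hi
    · exact absurd hi hx
    · exact third hac hbc had hbd hcd hce hde x hi
    · exact third had hbd hac hbc hcd.symm hde hce x hi
    · obtain ⟨s, hs, -, -, -, -, ls, -⟩ := e_nbrs x hi
      exact ⟨s, hs, ls⟩


/-! ### Coalition graphs of order six: sharp estimates and two cherries. -/

variable {V : Type v} {W : Type u} {G : SimpleGraph V} {cl : W → Set V} {H : SimpleGraph W}

/-- A class that together with the singleton `{q}` is connected contains a neighbour of `q`. -/
theorem exists_nbr_of_singleton (h : Realizes G cl H) {b x : W} {q : V} (hbx : H.Adj b x)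
    (hq : cl x = {q}) : ∃ z ∈ cl b, G.Adj q z := by
  obtain ⟨z, hz | hz, hqz⟩ := h.exists_nbr hbx q
  · exact ⟨z, hz, hqz⟩
  · rw [hq] at hz
    obtain rfl := hz
    exact absurd hqz (G.loopless.irrefl z)

/-- The vertex `q` is a leaf of the connected graph on `cl b ∪ {q}`. -/
theorem connected_of_singleton (h : Realizes G cl H) {b x : W} {q : V} (hbx : H.Adj b x)
    (hq : cl x = {q}) (huniq : ∀ y ∈ cl b, ∀ z ∈ cl b, G.Adj q y → G.Adj q z → y = z) :
    (G.induce (cl b)).Connected := by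
  refine connected_of_leaves (h.dominating hbx).2 (h.nonempty b) (h.disjoint b x hbx.ne) ?_
  intro l hl y hy z hz ly lz
  rw [hq] at hl hy hz
  obtain rfl := hl
  rcases hy with hy | rfl
  · rcases hz with hz | rfl
    · exact huniq y hy z hz ly lz
    · exact absurd lz (G.loopless.irrefl _)
  · exact absurd ly (G.loopless.irrefl _)

variable [Fintype V]

/-- Two of the edges leave at most two vertices for `cl e ∪ cl f`, and a connected dominating set of
order two allows only six vertices in all. -/
theorem no_perfect_matching_six (hG : IsSubcubic G) (h : Realizes G cl H) (hV : 7 ≤ Fintype.card V)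
    {a b c d e f : W} (hab : H.Adj a b) (hcd : H.Adj c d) (hac : a ≠ c) (had : a ≠ d)
    (hae : a ≠ e) (haf : a ≠ f) (hbc : b ≠ c) (hbd : b ≠ d) (hbe : b ≠ e) (hbf : b ≠ f)
    (hce : c ≠ e) (hcf : c ≠ f) (hde : d ≠ e) (hdf : d ≠ f) : ¬ H.Adj e f := by
  classical
  intro hef
  have h1 := h.sum_ncard_rest_le hG hab hcd hac had hbc hbd {e, f} (by simp [hae, haf])
    (by simp [hbe, hbf]) (by simp [hce, hcf]) (by simp [hde, hdf])
  rw [sum_pair hef.ne] at h1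
  have h2 := h.card_le_of_adj hG hef
  omega

/-- In a coalition graph of order six all estimates are sharp. -/
theorem tight_six [Fintype W] (hG : IsSubcubic G) (h : Realizes G cl H)
    {a b c d e f : W} (hab : H.Adj a b) (hcd : H.Adj c d) (hac : a ≠ c) (had : a ≠ d)
    (hae : a ≠ e) (haf : a ≠ f) (hbc : b ≠ c) (hbd : b ≠ d) (hbe : b ≠ e) (hbf : b ≠ f)
    (hce : c ≠ e) (hcf : c ≠ f) (hde : d ≠ e) (hdf : d ≠ f) (hef : e ≠ f)
    (hcov : ∀ i, i = a ∨ i = b ∨ i = c ∨ i = d ∨ i = e ∨ i = f) :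
    (∃ x, cl e = {x}) ∧ (∃ x, cl f = {x}) ∧
      Fintype.card V = 2 * (cl a ∪ cl b).ncard + 2 ∧
      Fintype.card V = 2 * (cl c ∪ cl d).ncard + 2 := by
  classical
  have h1 := h.card_le_of_adj hG hab
  have h2 := h.card_le_of_adj hG hcd
  have h3 := h.sum_ncard
  have hu : (univ : Finset W) = {a, b, c, d, e, f} := by
    ext i
    simpa using hcov i
  rw [hu, sum_insert (by simp [hab.ne, hac, had, hae, haf]),
    sum_insert (by simp [hbc, hbd, hbe, hbf]), sum_insert (by simp [hcd.ne, hce, hcf]),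
    sum_insert (by simp [hde, hdf]), sum_pair hef] at h3
  -- Adding `h1` and `h2` gives `|e| + |f| ≤ 2`; since both are at least one, every inequality is an
  -- equality.
  have he := h.one_le_ncard e
  have hf := h.one_le_ncard f
  rw [← Set.ncard_eq_one, ← Set.ncard_eq_one, h.ncard_union hab.ne, h.ncard_union hcd.ne]
  omega

/-- Pairing the edge `d e` with `a b` and with `a c` makes `b`, `c` and `f` singletons; then the
edge `b c` forces at most six vertices. -/
theorem no_triangle_and_edge_six (hG : IsSubcubic G) (h : Realizes G cl H)
    (hV : 7 ≤ Fintype.card V) {a b c d e f : W} (hab : H.Adj a b) (hac : H.Adj a c)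
    (hde : H.Adj d e) (had : a ≠ d) (hae : a ≠ e) (haf : a ≠ f) (hbd : b ≠ d) (hbe : b ≠ e)
    (hbf : b ≠ f) (hcd : c ≠ d) (hce : c ≠ e) (hcf : c ≠ f) (hdf : d ≠ f) (hef : e ≠ f) :
    ¬ H.Adj b c := by
  classical
  intro hbc
  have h1 := h.sum_ncard_rest_le hG hab hde had hae hbd hbe {c, f} (by simp [hac.ne, haf])
    (by simp [hbc.ne, hbf]) (by simp [hcd.symm, hdf]) (by simp [hce.symm, hef])
  have h2 := h.sum_ncard_rest_le hG hac hde had hae hcd hce {b, f} (by simp [hab.ne, haf])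
    (by simp [hbc.ne.symm, hcf]) (by simp [hbd.symm, hdf]) (by simp [hbe.symm, hef])
  rw [sum_pair hcf] at h1
  rw [sum_pair hbf] at h2
  have h3 := h.card_le_of_adj hG hbc
  have h4 := h.one_le_ncard f
  omega

/-- In a coalition graph of order six, no class has three neighbours disjoint from an edge. -/
theorem no_star_and_edge_six [Fintype W] (hG : IsSubcubic G) (h : Realizes G cl H)
    {b x y z d e : W} (hbx : H.Adj b x) (hby : H.Adj b y) (hbd : b ≠ d) (hbe : b ≠ e)
    (hxy : x ≠ y) (hxz : x ≠ z) (hxd : x ≠ d) (hxe : x ≠ e) (hyz : y ≠ z)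
    (hyd : y ≠ d) (hye : y ≠ e) (hzd : z ≠ d) (hze : z ≠ e) (hde : H.Adj d e)
    (hcov : ∀ i, i = b ∨ i = x ∨ i = y ∨ i = z ∨ i = d ∨ i = e) : ¬ H.Adj b z := by
  intro hbz
  obtain ⟨⟨q, hq⟩, ⟨r, hr⟩, hn, -⟩ := h.tight_six hG hbx hde hbd hbe hby.ne hbz.ne hxd hxe hxy hxz
    hyd.symm hzd.symm hye.symm hze.symm hyz
    (fun i => by rcases hcov i with h | h | h | h | h | h <;> simp [h])
  obtain ⟨⟨p, hp⟩, -, -⟩ := h.tight_six hG hby hde hbd hbe hbx.ne hbz.ne hyd hye hxy.symm hyz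
    hxd.symm hzd.symm hxe.symm hze.symm hxz
    (fun i => by rcases hcov i with h | h | h | h | h | h <;> simp [h])
  have mp : p ∈ cl x := by simp [hp]
  have mq : q ∈ cl y := by simp [hq]
  have mr : r ∈ cl z := by simp [hr]
  have huniq := ((h.dominating hbx).tight hG hn).2 q (by
    rintro (h' | h')
    exacts [h.notMem mq hby.ne.symm h', h.notMem mq hxy.symm h'])
  -- The classes `x`, `y`, `z` are singletons. A vertex without neighbour in `cl b` would be
  -- adjacent to all three and to a vertex of `cl d ∪ cl e`. Connectivity of `cl b` holds because
  -- `q` has a single neighbour in `cl b ∪ cl x`.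
  refine h.not_dominating hbx ⟨fun w hw => ?_, h.connected_of_singleton hby hq ?_⟩
  · by_contra! hcon
    have get : ∀ {i u}, H.Adj b i → cl i = {u} → G.Adj w u := by
      intro i u hi hu
      obtain ⟨s, hs | hs, hws⟩ := h.exists_nbr hi w
      · exact absurd hws (hcon s hs)
      · rw [hu] at hs
        exact hs ▸ hws
    have not_sing : ∀ {i u}, H.Adj b i → cl i = {u} → w ∉ cl i := by
      intro i u hi hu hwi
      obtain ⟨s, hs, hus⟩ := h.exists_nbr_of_singleton hi hu
      rw [hu] at hwi
      obtain rfl := hwi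
      exact hcon s hs hus
    obtain ⟨s, hs, hws⟩ := h.exists_nbr hde w
    have ne : ∀ {i u}, u ∈ cl i → i ≠ d → i ≠ e → u ≠ s := by
      intro i u hu hi hi'
      rcases hs with hs | hs
      exacts [h.ne_of_mem hu hs hi, h.ne_of_mem hu hs hi']
    exact hG.not_four (get hbx hp) (get hby hq) (get hbz hr) hws (h.ne_of_mem mp mq hxy)
      (h.ne_of_mem mp mr hxz) (ne mp hxd hxe) (h.ne_of_mem mq mr hyz) (ne mq hyd hye)
      (ne mr hzd hze)
  · intro s hs t ht qs qt
    exact huniq.unique ⟨Or.inl hs, qs⟩ ⟨Or.inl ht, qt⟩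

/-- Six classes, where each of `b` and `b'` is adjacent to two of the others. -/
structure TwoCherries (H : SimpleGraph W) (b x y b' x' y' : W) : Prop where
  bx : H.Adj b x
  byy : H.Adj b y
  bx' : H.Adj b' x'
  by' : H.Adj b' y'
  b_b' : b ≠ b'
  b_x' : b ≠ x'
  b_y' : b ≠ y'
  x_y : x ≠ y
  x_b' : x ≠ b'
  x_x' : x ≠ x'
  x_y' : x ≠ y'
  y_b' : y ≠ b'
  y_x' : y ≠ x'
  y_y' : y ≠ y'
  x'_y' : x' ≠ y'
  cover : ∀ i, i = b ∨ i = x ∨ i = y ∨ i = b' ∨ i = x' ∨ i = y'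

theorem TwoCherries.swap_left {b x y b' x' y' : W} (t : TwoCherries H b x y b' x' y') :
    TwoCherries H b y x b' x' y' where
  __ := t
  bx := t.byy
  byy := t.bx
  x_y := t.x_y.symm
  x_b' := t.y_b'
  x_x' := t.y_x'
  x_y' := t.y_y'
  y_b' := t.x_b'
  y_x' := t.x_x'
  y_y' := t.x_y'
  cover i := by rcases t.cover i with h | h | h | h | h | h <;> simp [h]

theorem TwoCherries.swap {b x y b' x' y' : W} (t : TwoCherries H b x y b' x' y') :
    TwoCherries H b' x' y' b x y where
  bx := t.bx'
  byy := t.by'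
  bx' := t.bx
  by' := t.byy
  b_b' := t.b_b'.symm
  b_x' := t.x_b'.symm
  b_y' := t.y_b'.symm
  x_y := t.x'_y'
  x_b' := t.b_x'.symm
  x_x' := t.x_x'.symm
  x_y' := t.y_x'.symm
  y_b' := t.b_y'.symm
  y_x' := t.x_y'.symm
  y_y' := t.y_y'.symm
  x'_y' := t.x_y
  cover i := by rcases t.cover i with h | h | h | h | h | h <;> simp [h]

variable [Fintype W]

theorem TwoCherries.tight {b x y b' x' y' : W} (t : TwoCherries H b x y b' x' y')
    (hG : IsSubcubic G) (h : Realizes G cl H) :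
    (∃ p, cl y = {p}) ∧ Fintype.card V = 2 * (cl b ∪ cl x).ncard + 2 :=
  have key := h.tight_six hG t.bx t.bx' t.b_b' t.b_x' t.byy.ne t.b_y' t.x_b' t.x_x' t.x_y t.x_y'
    t.y_b'.symm t.by'.ne t.y_x'.symm t.x'_y' t.y_y'
    (fun i => by rcases t.cover i with h | h | h | h | h | h <;> simp [h])
  ⟨key.1, key.2.2.1⟩

theorem TwoCherries.unique {b x y b' x' y' : W} (t : TwoCherries H b x y b' x' y')
    (hG : IsSubcubic G) (h : Realizes G cl H) {w : V} (hb : w ∉ cl b) (hx : w ∉ cl x) {s s' : V}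
    (hs : s ∈ cl b ∨ s ∈ cl x) (hs' : s' ∈ cl b ∨ s' ∈ cl x) (ws : G.Adj w s) (ws' : G.Adj w s') :
    s = s' :=
  (((h.dominating t.bx).tight hG (t.tight hG h).2).2 w (by
    rintro (h' | h')
    exacts [hb h', hx h'])).unique ⟨hs, ws⟩ ⟨hs', ws'⟩

/-- Sharpness gives `p` degree three. If `p` and `p'` were not adjacent, the uniqueness statements
for `b, y`, for `b', x'` and for `b', y'` would leave it only two neighbours, one in `cl b` and one
in `cl b'`. -/
theorem TwoCherries.adj_of_mem {b x y b' x' y' : W} (t : TwoCherries H b x y b' x' y')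
    (hG : IsSubcubic G) (h : Realizes G cl H) {p p' : V} (hp : p ∈ cl x) (hp' : p' ∈ cl x') :
    G.Adj p p' := by
  by_contra hcon
  have t' := t.swap_left
  obtain ⟨⟨p₁, hp₁⟩, -⟩ := t'.tight hG h
  obtain ⟨⟨p₂, hp₂⟩, -⟩ := t.swap.swap_left.tight hG h
  have e1 : p₁ = p := by rw [hp₁] at hp; exact hp.symm
  have e2 : p₂ = p' := by rw [hp₂] at hp'; exact hp'.symm
  subst e1 e2
  obtain ⟨s, hs, ps⟩ := h.exists_nbr_of_singleton t.bx hp₁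
  obtain ⟨r, hr0, pr⟩ := h.exists_nbr t.bx' p₁
  have hr : r ∈ cl b' := hr0.resolve_right (by
    rw [hp₂]
    rintro rfl
    exact hcon pr)
  have only : ∀ w, G.Adj p₁ w → w = s ∨ w = r := by
    intro w hw
    obtain ⟨i, hi⟩ := h.cover w
    rcases t.cover i with rfl | rfl | rfl | rfl | rfl | rfl
    · exact Or.inl (t'.unique hG h (h.notMem hp t.bx.ne.symm) (h.notMem hp t.x_y) (Or.inl hi)
        (Or.inl hs) hw ps)
    · rw [hp₁] at hi
      obtain rfl := hi
      exact absurd hw (G.loopless.irrefl w)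
    · have := t'.unique hG h (h.notMem hp t.bx.ne.symm) (h.notMem hp t.x_y) (Or.inr hi)
        (Or.inl hs) hw ps
      exact Or.inl this
    · exact Or.inr (t.swap.unique hG h (h.notMem hp t.x_b') (h.notMem hp t.x_x') (Or.inl hi)
        (Or.inl hr) hw pr)
    · exact Or.inr (t.swap.unique hG h (h.notMem hp t.x_b') (h.notMem hp t.x_x') (Or.inr hi)
        (Or.inl hr) hw pr)
    · exact Or.inr (t.swap.swap_left.unique hG h (h.notMem hp t.x_b') (h.notMem hp t.x_y')
        (Or.inr hi) (Or.inl hr) hw pr)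
  obtain ⟨u, v, w, huv, huw, hvw, hd⟩ := ((h.dominating t.bx).tight hG (t.tight hG h).2).1 p₁
    (Or.inr hp)
  have hu := only u ((hd u).2 (by simp))
  have hv := only v ((hd v).2 (by simp))
  have hw := only w ((hd w).2 (by simp))
  rcases hu with rfl | rfl <;> rcases hv with rfl | rfl <;> rcases hw with rfl | rfl <;>
    simp at huv huw hvw

/-- Both `cl b` and `cl b'` are connected, since a singleton class next to each is a leaf, and they
dominate the four singletons. Only an edge between them is still needed. -/
theorem TwoCherries.adj {b x y b' x' y' : W} (t : TwoCherries H b x y b' x' y')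
    (hG : IsSubcubic G) (h : Realizes G cl H) : H.Adj b b' := by
  have sing : ∀ {b x y b' x' y' : W}, TwoCherries H b x y b' x' y' →
      ∃ p q, cl x = {p} ∧ cl y = {q} ∧ (G.induce (cl b)).Connected := by
    intro b x y b' x' y' t
    obtain ⟨⟨p, hp⟩, -⟩ := t.swap_left.tight hG h
    obtain ⟨⟨q, hq⟩, -⟩ := t.tight hG h
    have mp : p ∈ cl x := by simp [hp]
    refine ⟨p, q, hp, hq, h.connected_of_singleton t.bx hp ?_⟩
    intro s hs r hr ps pr
    exact t.swap_left.unique hG h (h.notMem mp t.bx.ne.symm) (h.notMem mp t.x_y)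
      (Or.inl hs) (Or.inl hr) ps pr
  obtain ⟨p, q, hp, hq, hb⟩ := sing t
  obtain ⟨p', q', hp', hq', hb'⟩ := sing t.swap
  have mp : p ∈ cl x := by simp [hp]
  have mq : q ∈ cl y := by simp [hq]
  have mp' : p' ∈ cl x' := by simp [hp']
  obtain ⟨w, hw⟩ := h.nonempty b
  -- Otherwise `w` is adjacent to `p'`, whose neighbours already include `p`, `q` and a vertex of
  -- `cl b'`.
  have hww : ∃ r ∈ cl b', G.Adj w r := by
    obtain ⟨r, hr | hr, wr⟩ := h.exists_nbr t.bx' w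
    · exact ⟨r, hr, wr⟩
    · rw [hp'] at hr
      obtain rfl := hr
      have a1 := t.adj_of_mem hG h mp mp'
      have a2 := t.swap_left.adj_of_mem hG h mq mp'
      obtain ⟨s, hs, rs⟩ := h.exists_nbr_of_singleton t.bx' hp'
      exact (hG.not_four a1.symm a2.symm wr.symm rs (h.ne_of_mem mp mq t.x_y)
        (h.ne_of_mem mp hw t.bx.ne.symm) (h.ne_of_mem mp hs t.x_b')
        (h.ne_of_mem mq hw t.byy.ne.symm) (h.ne_of_mem mq hs t.y_b')
        (h.ne_of_mem hw hs t.b_b')).elim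
  obtain ⟨r, hr, wr⟩ := hww
  refine h.adj_of t.b_b' t.bx t.bx' ⟨?_, ?_⟩
  · intro z hz
    have single : ∀ {i j u}, H.Adj i j → cl j = {u} → z ∈ cl j → ∃ s ∈ cl i, G.Adj z s := by
      intro i j u hij hu hzj
      rw [hu] at hzj
      obtain rfl := hzj
      exact h.exists_nbr_of_singleton hij hu
    have left : (∃ s ∈ cl b, G.Adj z s) → ∃ s ∈ cl b ∪ cl b', G.Adj z s := fun ⟨s, hs, zs⟩ =>
      ⟨s, Or.inl hs, zs⟩
    have right : (∃ s ∈ cl b', G.Adj z s) → ∃ s ∈ cl b ∪ cl b', G.Adj z s := fun ⟨s, hs, zs⟩ =>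
      ⟨s, Or.inr hs, zs⟩
    obtain ⟨i, hi⟩ := h.cover z
    rcases t.cover i with rfl | rfl | rfl | rfl | rfl | rfl
    · exact absurd (Or.inl hi) hz
    · exact left (single t.bx hp hi)
    · exact left (single t.byy hq hi)
    · exact absurd (Or.inr hi) hz
    · exact right (single t.bx' hp' hi)
    · exact right (single t.by' hq' hi)
  · exact SimpleGraph.connected_induce_union hb.preconnected hb'.preconnected hw hr wr

end Realizes

/-! ### Edge lists and finite enumeration of adjacency tables. -/

/-- Adjacency in the graph on `0, …, n - 1` whose edges are listed in `es`. -/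
def listAdj {n : ℕ} (es : List (ℕ × ℕ)) (i j : Fin n) : Bool :=
  es.any fun e => (e.1 == i.1 && e.2 == j.1) || (e.1 == j.1 && e.2 == i.1)

/-- The graph on `0, …, n - 1` whose edges are listed in `es`. -/
def ofEdges (n : ℕ) (es : List (ℕ × ℕ)) : SimpleGraph (Fin n) where
  Adj i j := i ≠ j ∧ listAdj es i j = true
  symm := ⟨fun i j h => ⟨h.1.symm, by
    rw [← h.2]
    exact congrArg _ (funext fun e => Bool.or_comm _ _)⟩⟩
  loopless := ⟨fun _ h => h.1 rfl⟩

instance (n : ℕ) (es : List (ℕ × ℕ)) : DecidableRel (ofEdges n es).Adj := fun i j =>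
  inferInstanceAs (Decidable (i ≠ j ∧ listAdj es i j = true))

/-- The edge lists of the graphs in `sporadic`. -/
def sporadicEdges : List (ℕ × List (ℕ × ℕ)) :=
  [(1, []), (2, []), (3, []), (4, []),
   (3, [(0, 1), (1, 2), (0, 2)]),
   (4, [(0, 1), (2, 3)]),
   (4, [(0, 1), (1, 2), (2, 3)]),
   (4, [(0, 1), (1, 2), (2, 3), (0, 3)]),
   (4, [(0, 1), (1, 2), (0, 2), (0, 3)]),
   (4, [(0, 2), (0, 3), (1, 2), (1, 3), (2, 3)]),
   (4, [(0, 1), (0, 2), (0, 3), (1, 2), (1, 3), (2, 3)]),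
   (5, [(0, 1), (2, 3), (3, 4)]),
   (5, [(0, 1), (0, 2), (1, 3), (1, 4)]),
   (5, [(0, 1), (1, 2), (2, 3), (3, 4)]),
   (5, [(0, 1), (1, 2), (0, 2), (0, 3), (1, 4)]),
   (5, [(0, 1), (1, 2), (0, 2), (0, 3), (0, 4)]),
   (5, [(0, 1), (1, 2), (2, 3), (0, 3), (0, 4)]),
   (5, [(0, 1), (1, 2), (2, 3), (3, 4), (0, 4)]),
   (6, [(0, 1), (0, 2), (0, 3), (1, 4), (1, 5)]),
   (6, [(0, 1), (2, 3), (4, 5)]),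
   (5, [(0, 2), (0, 3), (0, 4), (1, 2), (1, 3), (1, 4)]),
   (6, [(0, 3), (0, 4), (0, 5), (1, 3), (1, 4), (1, 5), (2, 3), (2, 4), (2, 5)])]

theorem sigma_graph_eq {n : ℕ} {F F' : SimpleGraph (Fin n)} (h : ∀ i j, F.Adj i j ↔ F'.Adj i j) :
    (⟨n, F⟩ : (n : ℕ) × SimpleGraph (Fin n)) = ⟨n, F'⟩ := by
  congr
  ext i j
  exact h i j

theorem completeBipartite_adj {p q : ℕ} (i j : Fin (p + q)) :
    (completeBipartite p q).Adj i j ↔ (i.1 < p ∧ p ≤ j.1) ∨ (p ≤ i.1 ∧ j.1 < p) := by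
  unfold completeBipartite
  refine Fin.addCases (fun a => ?_) (fun a => ?_) i <;>
    refine Fin.addCases (fun b => ?_) (fun b => ?_) j <;> simp

theorem disjUnion_adj {m n : ℕ} (F : SimpleGraph (Fin m)) (F' : SimpleGraph (Fin n))
    (i j : Fin (m + n)) : (disjUnion F F').Adj i j ↔
      (∃ (hi : i.1 < m) (hj : j.1 < m), F.Adj ⟨i, hi⟩ ⟨j, hj⟩) ∨
      (∃ (hi : m ≤ i.1) (hj : m ≤ j.1), F'.Adj ⟨i - m, by omega⟩ ⟨j - m, by omega⟩) := by
  unfold disjUnion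
  refine Fin.addCases (fun a => ?_) (fun a => ?_) i <;>
    refine Fin.addCases (fun b => ?_) (fun b => ?_) j <;> simp

instance {m n : ℕ} (F : SimpleGraph (Fin m)) (F' : SimpleGraph (Fin n)) [DecidableRel F.Adj]
    [DecidableRel F'.Adj] : DecidableRel (disjUnion F F').Adj := fun i j =>
  decidable_of_iff' _ (disjUnion_adj F F' i j)

/-- Passing to edge lists makes all later statements about the sporadic graphs decidable by
evaluation. -/
theorem sporadic_eq : sporadic = sporadicEdges.map fun t => ⟨t.1, ofEdges t.1 t.2⟩ := by
  simp only [sporadic, sporadicEdges, List.map_cons, List.map_nil]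
  refine congrArg₂ _ (sigma_graph_eq ?_) (congrArg₂ _ (sigma_graph_eq ?_) (congrArg₂ _ (sigma_graph_eq ?_)
    (congrArg₂ _ (sigma_graph_eq ?_) (congrArg₂ _ (sigma_graph_eq ?_) (congrArg₂ _ (sigma_graph_eq ?_)
    (congrArg₂ _ (sigma_graph_eq ?_) (congrArg₂ _ (sigma_graph_eq ?_) (congrArg₂ _ (sigma_graph_eq ?_)
    (congrArg₂ _ (sigma_graph_eq ?_) (congrArg₂ _ (sigma_graph_eq ?_) (congrArg₂ _ (sigma_graph_eq ?_)
    (congrArg₂ _ (sigma_graph_eq ?_) (congrArg₂ _ (sigma_graph_eq ?_) (congrArg₂ _ (sigma_graph_eq ?_)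
    (congrArg₂ _ (sigma_graph_eq ?_) (congrArg₂ _ (sigma_graph_eq ?_) (congrArg₂ _ (sigma_graph_eq ?_)
    (congrArg₂ _ (sigma_graph_eq ?_) (congrArg₂ _ (sigma_graph_eq ?_) (congrArg₂ _ (sigma_graph_eq ?_)
    (congrArg₂ _ (sigma_graph_eq ?_) rfl)))))))))))))))))))))
  · decide
  · decide
  · decide
  · decide
  · decide
  · decide
  · intro i j; rw [SimpleGraph.pathGraph_adj]; revert i j; decide
  · decide
  · simp only [triangleE, SimpleGraph.fromEdgeSet_adj, Set.mem_insert_iff, Set.mem_singleton_iff]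
    decide
  · simp only [SimpleGraph.deleteEdges_adj, Set.mem_singleton_iff]
    decide
  · decide
  · intro i j
    rw [disjUnion_adj]
    simp only [SimpleGraph.pathGraph_adj]
    revert i j
    decide
  · simp only [doubleStar12, SimpleGraph.fromEdgeSet_adj, Set.mem_insert_iff, Set.mem_singleton_iff]
    decide
  · intro i j; rw [SimpleGraph.pathGraph_adj]; revert i j; decide
  · simp only [triangleEE, SimpleGraph.fromEdgeSet_adj, Set.mem_insert_iff, Set.mem_singleton_iff]
    decide
  · simp only [triangle2E, SimpleGraph.fromEdgeSet_adj, Set.mem_insert_iff, Set.mem_singleton_iff]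
    decide
  · simp only [squareE, SimpleGraph.fromEdgeSet_adj, Set.mem_insert_iff, Set.mem_singleton_iff]
    decide
  · decide
  · simp only [doubleStar22, SimpleGraph.fromEdgeSet_adj, Set.mem_insert_iff, Set.mem_singleton_iff]
    decide
  · decide
  · refine fun i j => (completeBipartite_adj (p := 2) (q := 3) i j).trans ?_
    revert i j
    decide
  · refine fun i j => (completeBipartite_adj (p := 3) (q := 3) i j).trans ?_
    revert i j
    decide

section Tables

variable {W : Type u} {H : SimpleGraph W}

theorem iso_of_table {k : ℕ} {F : SimpleGraph (Fin k)} {f : Fin k → W} (hf : Function.Bijective f)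
    (h : ∀ i j, H.Adj (f i) (f j) ↔ F.Adj i j) : Nonempty (H ≃g F) := by
  refine ⟨(SimpleGraph.Iso.symm ⟨Equiv.ofBijective f hf, ?_⟩)⟩
  intro i j
  exact h i j

/-- The adjacency table of four labelled vertices with edges `01` and `23`. -/
def table4 (a b c d : Bool) : Fin 4 → Fin 4 → Bool :=
  ![![false, true, a, b], ![true, false, c, d], ![a, c, false, true], ![b, d, true, false]]

/-- The adjacency table of five labelled vertices with edges `01`, `23` and `04`. -/
def table5 (a b c d e f g : Bool) : Fin 5 → Fin 5 → Bool :=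
  ![![false, true, a, b, true], ![true, false, c, d, e], ![a, c, false, true, f],
    ![b, d, true, false, g], ![true, e, f, g, false]]

/-- Some relabelling turns the table into a graph of the list. -/
def Matches {k : ℕ} (t : Fin k → Fin k → Bool) (L : List (ℕ × List (ℕ × ℕ)))
    (perms : List (Fin k → Fin k)) : Prop :=
  ∃ F ∈ L, F.1 = k ∧ ∃ p ∈ perms, ∀ i j, t (p i) (p j) = decide (i ≠ j ∧ listAdj F.2 i j = true)

instance {k : ℕ} (t : Fin k → Fin k → Bool) (L : List (ℕ × List (ℕ × ℕ)))
    (perms : List (Fin k → Fin k)) : Decidable (Matches t L perms) := by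
  unfold Matches
  infer_instance

/-- A few relabellings that suffice for `matches4`, instead of all permutations; `perms5` and
`perms6` play the same role. -/
def perms4 : List (Fin 4 → Fin 4) :=
  [![0, 1, 2, 3], ![0, 2, 3, 1], ![1, 2, 3, 0], ![3, 0, 1, 2], ![0, 1, 3, 2], ![1, 0, 2, 3],
   ![1, 0, 3, 2], ![1, 3, 0, 2], ![2, 0, 1, 3]]

def perms5 : List (Fin 5 → Fin 5) :=
  [![0, 2, 3, 1, 4], ![2, 3, 1, 0, 4], ![0, 1, 2, 3, 4], ![0, 3, 1, 4, 2], ![0, 2, 1, 4, 3],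
   ![0, 2, 3, 4, 1], ![0, 2, 4, 1, 3], ![0, 3, 2, 4, 1], ![0, 3, 4, 1, 2], ![1, 0, 4, 2, 3],
   ![1, 0, 4, 3, 2], ![2, 0, 3, 1, 4], ![2, 1, 0, 4, 3], ![3, 0, 2, 1, 4], ![3, 1, 0, 4, 2],
   ![3, 2, 1, 0, 4]]

theorem perms4_injective : ∀ p ∈ perms4, Function.Injective p := by
  decide +kernel

theorem matches4 : ∀ a b c d, Matches (table4 a b c d) sporadicEdges perms4 := by
  decide +kernel

/-- The table contains a triangle and a disjoint edge. -/
def HasTriangleEdge (t : Fin 5 → Fin 5 → Bool) : Prop :=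
  ∃ a b, t a b = true ∧ ∃ c, t a c = true ∧ t b c = true ∧ ∃ d, a ≠ d ∧ b ≠ d ∧ c ≠ d ∧
    ∃ e, a ≠ e ∧ b ≠ e ∧ c ≠ e ∧ t d e = true

/-- The table contains two triangles with a common edge and a fifth vertex adjacent to one of its
ends. -/
def HasDart (t : Fin 5 → Fin 5 → Bool) : Prop :=
  ∃ a b, t a b = true ∧ ∃ c, t a c = true ∧ t b c = true ∧ ∃ d, t a d = true ∧ t b d = true ∧
    c ≠ d ∧ ∃ e, a ≠ e ∧ c ≠ e ∧ d ≠ e ∧ t b e = true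

instance : DecidablePred HasTriangleEdge := fun t => by unfold HasTriangleEdge; infer_instance

instance : DecidablePred HasDart := fun t => by unfold HasDart; infer_instance

theorem perms5_injective : ∀ p ∈ perms5, Function.Injective p := by
  decide +kernel

/-- Two disjoint edges and a fifth vertex attached to one end leave seven free pairs, so 128 tables.
-/
theorem matches5 : ∀ a b c d e f g, HasTriangleEdge (table5 a b c d e f g) ∨
    HasDart (table5 a b c d e f g) ∨ Matches (table5 a b c d e f g) sporadicEdges perms5 := by
  decide +kernel

theorem Matches.exists_iso {k : ℕ} {t : Fin k → Fin k → Bool} {perms : List (Fin k → Fin k)}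
    (h : Matches t sporadicEdges perms) (hp : ∀ p ∈ perms, Function.Injective p) {f : Fin k → W}
    (hf : Function.Bijective f) (ht : ∀ i j, H.Adj (f i) (f j) ↔ t i j = true) :
    ∃ F ∈ sporadic, Nonempty (H ≃g F.2) := by
  obtain ⟨⟨n, es⟩, hF, rfl, p, hpm, key⟩ := h
  refine ⟨⟨n, ofEdges n es⟩, ?_, ?_⟩
  · rw [sporadic_eq]
    exact List.mem_map.2 ⟨_, hF, rfl⟩
  · refine iso_of_table (hf.comp (Finite.injective_iff_bijective.1 (hp p hpm))) fun i j => ?_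
    rw [Function.comp_apply, Function.comp_apply, ht, key]
    simp [ofEdges]

end Tables

/-! ### Graphs without two disjoint edges. -/

section Abstract

variable {W : Type u} {H : SimpleGraph W}

theorem sporadic_of_table {k : ℕ} {es : List (ℕ × ℕ)} (hmem : (k, es) ∈ sporadicEdges)
    {f : Fin k → W} (hf : Function.Bijective f)
    (h : ∀ i j, H.Adj (f i) (f j) ↔ (ofEdges k es).Adj i j) :
    ∃ F ∈ sporadic, Nonempty (H ≃g F.2) := by
  refine ⟨⟨k, ofEdges k es⟩, ?_, iso_of_table hf h⟩
  rw [sporadic_eq]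
  exact List.mem_map.2 ⟨_, hmem, rfl⟩

theorem iso_star [Finite W] {c d : W} (hcd : c ≠ d)
    (h : ∀ i j, H.Adj i j ↔ i ≠ j ∧ (i = c ∨ j = c)) :
    ∃ k : ℕ, 2 ≤ k ∧ Nonempty (H ≃g star k) := by
  classical
  have := Fintype.ofFinite W
  have h2 : 1 < Fintype.card W := Fintype.one_lt_card_iff.2 ⟨c, d, hcd⟩
  obtain ⟨m, hm⟩ : ∃ m, Fintype.card W = m + 1 := ⟨Fintype.card W - 1, by omega⟩
  let e₀ : W ≃ Fin (m + 1) := Fintype.equivFinOfCardEq hm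
  let e : W ≃ Fin (m + 1) := e₀.trans (Equiv.swap (e₀ c) 0)
  have hc : e c = 0 := by simp [e]
  refine ⟨m + 1, by omega, ⟨⟨e, ?_⟩⟩⟩
  intro i j
  rw [h, star, SimpleGraph.starGraph_adj, ← hc]
  simp

/-- A graph without isolated vertices and without two disjoint edges is a star or a triangle. -/
theorem star_or_triangle [Finite W] [Nonempty W] (hiso : ∀ i, ∃ j, H.Adj i j)
    (hmat : ∀ a b c d, H.Adj a b → H.Adj c d → a ≠ c → a ≠ d → b ≠ c → b ≠ d → False) :
    (∃ k : ℕ, 2 ≤ k ∧ Nonempty (H ≃g star k)) ∨ ∃ F ∈ sporadic, Nonempty (H ≃g F.2) := by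
  classical
  obtain ⟨a⟩ := ‹Nonempty W›
  obtain ⟨b, hab⟩ := hiso a
  have cstar : ∀ {c d}, c ≠ d → (∀ i j, H.Adj i j → i = c ∨ j = c) →
      ∃ k : ℕ, 2 ≤ k ∧ Nonempty (H ≃g star k) := by
    intro c d hcd hall
    have hadj : ∀ i, i ≠ c → H.Adj i c := by
      intro i hi
      obtain ⟨j, hj⟩ := hiso i
      rcases hall i j hj with h | rfl
      · exact absurd h hi
      · exact hj
    refine iso_star hcd fun i j => ⟨fun hij => ⟨hij.ne, hall i j hij⟩, ?_⟩
    rintro ⟨hij, rfl | rfl⟩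
    · exact (hadj j hij.symm).symm
    · exact hadj i hij
  by_cases h1 : ∀ i j, H.Adj i j → i = a ∨ j = a
  · exact Or.inl (cstar hab.ne h1)
  by_cases h2 : ∀ i j, H.Adj i j → i = b ∨ j = b
  · exact Or.inl (cstar hab.ne.symm h2)
  have ha : ∃ z, z ≠ a ∧ H.Adj b z := by
    push Not at h1
    obtain ⟨i, j, hij, hi, hj⟩ := h1
    by_cases hib : i = b
    · exact ⟨j, hj, hib ▸ hij⟩
    · by_cases hjb : j = b
      · exact ⟨i, hi, hjb ▸ hij.symm⟩
      · exact (hmat a b i j hab hij (Ne.symm hi) (Ne.symm hj) (Ne.symm hib) (Ne.symm hjb)).elim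
  have hb : ∃ z, z ≠ b ∧ H.Adj a z := by
    push Not at h2
    obtain ⟨i, j, hij, hi, hj⟩ := h2
    by_cases hia : i = a
    · exact ⟨j, hj, hia ▸ hij⟩
    · by_cases hja : j = a
      · exact ⟨i, hi, hja ▸ hij.symm⟩
      · exact (hmat a b i j hab hij (Ne.symm hia) (Ne.symm hja) (Ne.symm hi) (Ne.symm hj)).elim
  obtain ⟨z, hza, hbz⟩ := ha
  obtain ⟨w, hwb, haw⟩ := hb
  -- Neither end of `a b` meets all edges, so each end has another neighbour; distinct ones would
  -- give two disjoint edges.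
  have hzw : z = w := by
    by_contra hne
    exact hmat b z a w hbz haw hab.ne.symm (Ne.symm hwb) hza hne
  subst hzw
  -- The neighbour of a fourth vertex would have to lie on all three edges of the triangle.
  have hall : ∀ i, i = a ∨ i = b ∨ i = z := by
    intro i
    by_contra! hi
    obtain ⟨ia, ib, iz⟩ := hi
    obtain ⟨j, hj⟩ := hiso i
    have m1 : j = a ∨ j = b := by
      by_contra! hc
      exact hmat i j a b hj hab ia ib hc.1 hc.2
    have m2 : j = b ∨ j = z := by
      by_contra! hc
      exact hmat i j b z hj hbz ib iz hc.1 hc.2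
    have m3 : j = a ∨ j = z := by
      by_contra! hc
      exact hmat i j a z hj haw ia iz hc.1 hc.2
    rcases m1 with rfl | rfl
    · rcases m2 with h | h
      · exact hab.ne h
      · exact haw.ne h
    · rcases m3 with h | h
      · exact hab.ne h.symm
      · exact hbz.ne h
  refine Or.inr (sporadic_of_table (k := 3) (es := [(0, 1), (1, 2), (0, 2)])
    (by simp [sporadicEdges]) (f := ![a, b, z]) ⟨?_, ?_⟩ ?_)
  · intro i j hij
    fin_cases i <;> fin_cases j <;>
      simp_all [hab.ne, hab.ne.symm, hbz.ne, hbz.ne.symm, haw.ne, haw.ne.symm]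
  · intro i
    rcases hall i with rfl | rfl | rfl
    exacts [⟨0, rfl⟩, ⟨1, rfl⟩, ⟨2, rfl⟩]
  · intro i j
    fin_cases i <;> fin_cases j <;>
      simp [ofEdges, listAdj, hab, hbz, haw, hab.symm, hbz.symm, haw.symm]

end Abstract

/-! ### Six singleton classes: dominating edges of cubic graphs on six vertices. -/

section Six

theorem injective_vec_six {W : Type u} {a b c d e f : W} (h : [a, b, c, d, e, f].Nodup) :
    Function.Injective ![a, b, c, d, e, f] := by
  rw [← List.nodup_ofFn]
  simpa [List.ofFn_succ] using h

/-- Adjacency table of a cubic graph in which `01` is a dominating edge. -/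
def table6 (a b c d e f : Bool) : Fin 6 → Fin 6 → Bool :=
  ![![false, true, true, true, false, false], ![true, false, false, false, true, true],
    ![true, false, false, a, b, c], ![true, false, a, false, d, e],
    ![false, true, b, d, false, f], ![false, true, c, e, f, false]]

def HasDegreeThree (t : Fin 6 → Fin 6 → Bool) (x : Fin 6) : Prop :=
  ∃ i, t x i = true ∧ ∃ j, i ≠ j ∧ t x j = true ∧ ∃ k, i ≠ k ∧ j ≠ k ∧ t x k = true ∧
    ∀ z, t x z = true → z = i ∨ z = j ∨ z = k

instance (t : Fin 6 → Fin 6 → Bool) : DecidablePred (HasDegreeThree t) := fun x => by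
  unfold HasDegreeThree
  infer_instance

/-- The dominating edges of a table. -/
def dominatingEdge (t : Fin 6 → Fin 6 → Bool) (i j : Fin 6) : Bool :=
  t i j && decide (∀ k, k ≠ i → k ≠ j → t k i = true ∨ t k j = true)

def perms6 : List (Fin 6 → Fin 6) :=
  [![0, 4, 5, 1, 2, 3], ![0, 1, 2, 4, 3, 5], ![0, 1, 2, 5, 3, 4]]

theorem perms6_injective : ∀ p ∈ perms6, Function.Injective p := by
  intro p hp
  simp only [perms6, List.mem_cons, List.not_mem_nil, or_false] at hp
  rcases hp with rfl | rfl | rfl <;> exact injective_vec_six (by decide)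

/-- The cubic graphs that occur are `K_{3,3}`, where every edge dominates, and the prism, where only
the three edges between the triangles do. -/
theorem matches6 : ∀ a b c d e f, (∀ x, HasDegreeThree (table6 a b c d e f) x) →
    Matches (dominatingEdge (table6 a b c d e f)) sporadicEdges perms6 := by
  decide +kernel

end Six

namespace Realizes

variable {V : Type v} {W : Type u} {G : SimpleGraph V} {cl : W → Set V} {H : SimpleGraph W}

theorem exists_singletons [Fintype V] [Fintype W] (h : Realizes G cl H)
    (hVW : Fintype.card V = Fintype.card W) :
    ∃ f : W → V, Function.Bijective f ∧ ∀ i, cl i = {f i} := by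
  have h1 : ∑ _i : W, 1 = ∑ i, (cl i).ncard := by
    rw [h.sum_ncard, hVW]
    simp
  have h2 := (sum_eq_sum_iff_of_le fun i _ => h.one_le_ncard i).1 h1
  have h3 : ∀ i, ∃ x, cl i = {x} := fun i => Set.ncard_eq_one.1 (h2 i (mem_univ i)).symm
  choose f hf using h3
  refine ⟨f, ⟨fun i j hij => ?_, fun x => ?_⟩, hf⟩
  · by_contra hne
    exact h.ne_of_mem (by rw [hf i]; rfl) (by rw [hf j]; rfl) hne hij
  · obtain ⟨i, hi⟩ := h.cover x
    rw [hf i] at hi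
    exact ⟨i, hi.symm⟩

/-- With at least five vertices no single vertex dominates, so a coalition of singletons is the same
as a dominating edge. -/
theorem adj_iff_of_singletons [Fintype V] (hG : IsSubcubic G) (h : Realizes G cl H)
    (hV : 5 ≤ Fintype.card V) {f : W → V} (hf : Function.Bijective f) (hcl : ∀ i, cl i = {f i})
    (i j : W) : H.Adj i j ↔
      G.Adj (f i) (f j) ∧ ∀ k, k ≠ i → k ≠ j → G.Adj (f k) (f i) ∨ G.Adj (f k) (f j) := by
  have key : ∀ {i j}, H.Adj i j → ∀ x, G.Adj x (f i) ∨ G.Adj x (f j) := by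
    intro i j hij x
    obtain ⟨y, hy, hxy⟩ := h.exists_nbr hij x
    rw [hcl, hcl] at hy
    rcases hy with rfl | rfl
    exacts [Or.inl hxy, Or.inr hxy]
  have nd : ∀ i, ¬ IsConnectedDominating G (cl i) := by
    intro i hi
    have := hi.card_le hG
    rw [hcl, Set.ncard_singleton] at this
    omega
  constructor
  · exact fun hij => ⟨(key hij (f i)).resolve_left (G.loopless.irrefl _), fun k _ _ => key hij _⟩
  · rintro ⟨hij, hdom⟩
    have hne : i ≠ j := by
      rintro rfl
      exact G.loopless.irrefl _ hij
    refine (h.adj_iff i j).2 ⟨h.disjoint i j hne, nd i, nd j, ?_⟩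
    rw [hcl, hcl, Set.singleton_union]
    refine ⟨fun x hx => ?_, G.induce_pair_connected_of_adj hij⟩
    obtain ⟨k, rfl⟩ := hf.2 x
    simp only [Set.mem_insert_iff, Set.mem_singleton_iff, not_or] at hx
    rcases hdom k (fun h => hx.1 (by rw [h])) (fun h => hx.2 (by rw [h])) with h' | h'
    · exact ⟨_, Or.inl rfl, h'⟩
    · exact ⟨_, Or.inr rfl, h'⟩

theorem exists_adj [Fintype V] (hG : IsSubcubic G) (h : Realizes G cl H)
    (hV : 5 ≤ Fintype.card V) (i : W) : ∃ j, H.Adj i j := by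
  rcases h.single_or_adj i with ⟨hi, x, hx⟩ | h'
  · have := hi.card_le hG
    rw [hx, Set.ncard_singleton] at this
    omega
  · exact h'

/-- Six equals `2 * 2 + 2`, so every coalition is sharp and `G` is cubic. The ends of a dominating
edge `i j` have disjoint further neighbourhoods `{a, b}` and `{c, d}`, which labels all vertices and
leaves six unknown pairs. -/
theorem sporadic_of_card_six [Fintype V] [Fintype W] (hG : IsSubcubic G) (h : Realizes G cl H)
    (hV : Fintype.card V = 6) (hW : Fintype.card W = 6) :
    ∃ F ∈ sporadic, Nonempty (H ≃g F.2) := by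
  classical
  obtain ⟨f, hf, hcl⟩ := h.exists_singletons (hV.trans hW.symm)
  have hadj := h.adj_iff_of_singletons hG (by omega) hf hcl
  have hiso := h.exists_adj hG (by omega)
  have tight : ∀ {i j}, H.Adj i j → _ := fun {i j} hij =>
    (h.dominating hij).tight hG (by
      rw [hcl, hcl, Set.singleton_union, Set.ncard_pair (hf.1.ne hij.ne), hV])
  have deg : ∀ x j, H.Adj x j → ∀ y, G.Adj (f x) (f y) → ∃ a b, y ≠ a ∧ y ≠ b ∧ a ≠ b ∧
      ∀ z, G.Adj (f x) (f z) ↔ z = y ∨ z = a ∨ z = b := by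
    intro x j hxj y hxy
    obtain ⟨a', b', c', hab, hac, hbc, hd⟩ := (tight hxj).1 (f x) (Or.inl (by rw [hcl]; rfl))
    obtain ⟨a, rfl⟩ := hf.2 a'
    obtain ⟨b, rfl⟩ := hf.2 b'
    obtain ⟨c, rfl⟩ := hf.2 c'
    have hd' : ∀ z, G.Adj (f x) (f z) ↔ z = a ∨ z = b ∨ z = c := by
      intro z
      rw [hd, hf.1.eq_iff, hf.1.eq_iff, hf.1.eq_iff]
    have hab := fun h => hab (congrArg f h)
    have hac := fun h => hac (congrArg f h)
    have hbc := fun h => hbc (congrArg f h)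
    rcases (hd' y).1 hxy with rfl | rfl | rfl
    · exact ⟨b, c, hab, hac, hbc, hd'⟩
    · exact ⟨a, c, Ne.symm hab, hbc, hac, fun z => (hd' z).trans (by tauto)⟩
    · exact ⟨a, b, Ne.symm hac, Ne.symm hbc, hab, fun z => (hd' z).trans (by tauto)⟩
  obtain ⟨i⟩ : Nonempty W := Fintype.card_pos_iff.1 (by omega)
  obtain ⟨j, hij⟩ := hiso i
  have gij := ((hadj i j).1 hij).1
  obtain ⟨a, b, hja, hjb, hab, hi⟩ := deg i j hij j gij
  obtain ⟨c, d, hic, hid, hcd, hj⟩ := deg j i hij.symm i gij.symm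
  have sep : ∀ k, k ≠ i → k ≠ j → G.Adj (f i) (f k) → G.Adj (f j) (f k) → False := by
    intro k hki hkj h1 h2
    have := ((tight hij).2 (f k) (by
      rw [hcl, hcl, Set.singleton_union]
      simp [hf.1.eq_iff, hki, hkj])).unique ⟨Or.inl (by rw [hcl]; rfl), h1.symm⟩
        ⟨Or.inr (by rw [hcl]; rfl), h2.symm⟩
    exact hij.ne (hf.1 this)
  have gne : ∀ {k l}, G.Adj (f k) (f l) → k ≠ l := by
    rintro k l hkl rfl
    exact G.loopless.irrefl _ hkl
  have gia := (hi a).2 (by simp)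
  have gib := (hi b).2 (by simp)
  have gjc := (hj c).2 (by simp)
  have gjd := (hj d).2 (by simp)
  have hia := gne gia
  have hib := gne gib
  have hjc := gne gjc
  have hjd := gne gjd
  have nja : ¬ G.Adj (f j) (f a) := fun h' => sep a hia.symm hja.symm gia h'
  have njb : ¬ G.Adj (f j) (f b) := fun h' => sep b hib.symm hjb.symm gib h'
  have nic : ¬ G.Adj (f i) (f c) := fun h' => sep c hic.symm hjc.symm h' gjc
  have nid : ¬ G.Adj (f i) (f d) := fun h' => sep d hid.symm hjd.symm h' gjd
  have hac : a ≠ c := by rintro rfl; exact nic gia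
  have had : a ≠ d := by rintro rfl; exact nid gia
  have hbc : b ≠ c := by rintro rfl; exact nic gib
  have hbd : b ≠ d := by rintro rfl; exact nid gib
  let g : Fin 6 → W := ![i, j, a, b, c, d]
  have hginj : Function.Injective g := injective_vec_six (by
    simp [hij.ne, hia, hib, hic, hid, hja, hjb, hjc, hjd, hab, hac, had, hbc, hbd, hcd])
  have hg : Function.Bijective g :=
    (Fintype.bijective_iff_injective_and_card g).2 ⟨hginj, by simp [hW]⟩
  obtain ⟨A, hA⟩ : ∃ A : W → W → Bool, ∀ p q, A p q = true ↔ G.Adj (f p) (f q) :=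
    ⟨fun p q => decide (G.Adj (f p) (f q)), fun p q => by simp⟩
  have ht : ∀ p q, table6 (A a b) (A a c) (A a d) (A b c) (A b d) (A c d) p q = A (g p) (g q) := by
    have hcomm : ∀ p q, A p q = A q p := fun p q => by
      rw [Bool.eq_iff_iff, hA, hA, G.adj_comm]
    have hself : ∀ p, A p p = false := fun p => by
      rw [← Bool.not_eq_true, hA]
      exact G.loopless.irrefl _
    have hf' : ∀ {p q}, ¬ G.Adj (f p) (f q) → A p q = false := fun h' => by
      rwa [← Bool.not_eq_true, hA]
    have ht' : ∀ {p q}, G.Adj (f p) (f q) → A p q = true := fun h' => (hA _ _).2 h'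
    intro p q
    fin_cases p <;> fin_cases q <;>
      first
        | exact rfl | exact hcomm _ _ | exact (hself _).symm | exact (ht' gij).symm
        | exact (ht' gij.symm).symm | exact (ht' gia).symm | exact (ht' gia.symm).symm
        | exact (ht' gib).symm | exact (ht' gib.symm).symm | exact (ht' gjc).symm
        | exact (ht' gjc.symm).symm | exact (ht' gjd).symm | exact (ht' gjd.symm).symm
        | exact (hf' nja).symm | exact (hf' (mt SimpleGraph.Adj.symm nja)).symm
        | exact (hf' njb).symm | exact (hf' (mt SimpleGraph.Adj.symm njb)).symm
        | exact (hf' nic).symm | exact (hf' (mt SimpleGraph.Adj.symm nic)).symm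
        | exact (hf' nid).symm | exact (hf' (mt SimpleGraph.Adj.symm nid)).symm
  refine (matches6 (A a b) (A a c) (A a d) (A b c) (A b d) (A c d) ?_).exists_iso
    perms6_injective hg ?_
  · intro x
    obtain ⟨y, hxy⟩ := hiso (g x)
    obtain ⟨u, w, hyu, hyw, huw, hd⟩ := deg (g x) y hxy y ((hadj _ _).1 hxy).1
    obtain ⟨y', rfl⟩ := hg.2 y
    obtain ⟨u', rfl⟩ := hg.2 u
    obtain ⟨w', rfl⟩ := hg.2 w
    simp only [HasDegreeThree, ht, hA]
    refine ⟨y', (hd _).2 (by simp), u', fun h' => hyu (congrArg g h'), (hd _).2 (by simp), w',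
      fun h' => hyw (congrArg g h'), fun h' => huw (congrArg g h'), (hd _).2 (by simp), ?_⟩
    intro z hz
    have := (hd _).1 hz
    simpa only [hginj.eq_iff] using this
  · intro p q
    rw [hadj]
    simp only [dominatingEdge, ht, hA, Bool.and_eq_true, decide_eq_true_eq]
    refine and_congr_right fun _ => ⟨fun h' k hk hk' => h' (g k) (hginj.ne hk) (hginj.ne hk'),
      fun h' k hk hk' => ?_⟩
    obtain ⟨k', rfl⟩ := hg.2 k
    exact h' k' (fun h => hk (congrArg g h)) (fun h => hk' (congrArg g h))

section TwoCherries

variable [Fintype V] [Fintype W]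

/-- The edge `b b'` is present. Any other additional edge creates a triangle with a disjoint edge
(`n1`), a vertex with three neighbours and a disjoint edge (`n2`), or a perfect matching (`n3`). -/
theorem TwoCherries.iso {b x y b' x' y' : W} (t : TwoCherries H b x y b' x' y')
    (hG : IsSubcubic G) (h : Realizes G cl H) (hV : 7 ≤ Fintype.card V) :
    ∃ F ∈ sporadic, Nonempty (H ≃g F.2) := by
  have n1 : ∀ {b x y b' x' y' : W}, TwoCherries H b x y b' x' y' → ¬ H.Adj x y := fun t =>
    h.no_triangle_and_edge_six hG hV t.bx t.byy t.bx' t.b_b' t.b_x' t.b_y' t.x_b' t.x_x' t.x_y'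
      t.y_b' t.y_x' t.y_y' t.by'.ne t.x'_y'
  have n2 : ∀ {b x y b' x' y' : W}, TwoCherries H b x y b' x' y' → ¬ H.Adj x b' := fun t h' =>
    h.no_star_and_edge_six hG t.bx' t.by' t.b_b'.symm t.y_b'.symm t.x'_y' t.x_x'.symm t.b_x'.symm
      t.y_x'.symm t.x_y'.symm t.b_y'.symm t.y_y'.symm t.bx.ne.symm t.x_y t.byy
      (fun i => by rcases t.cover i with h | h | h | h | h | h <;> simp [h]) h'.symm
  have n3 : ∀ {b x y b' x' y' : W}, TwoCherries H b x y b' x' y' → ¬ H.Adj x x' := fun t =>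
    h.no_perfect_matching_six hG hV t.byy t.by' t.b_b' t.b_y' t.bx.ne t.b_x' t.y_b' t.y_y'
      t.x_y.symm t.y_x' t.x_b'.symm t.bx'.ne t.x_y'.symm t.x'_y'.symm
  have a1 := t.adj hG h
  have b1 := n1 t
  have b2 := n1 t.swap
  have c1 := n2 t
  have c2 := n2 t.swap_left
  have c3 := n2 t.swap
  have c4 := n2 t.swap.swap_left
  have d1 := n3 t
  have d2 := n3 t.swap_left
  have d3 := n3 t.swap.swap_left
  have d4 := n3 t.swap_left.swap.swap_left
  refine sporadic_of_table (k := 6) (es := [(0, 1), (0, 2), (0, 3), (1, 4), (1, 5)])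
    (by simp [sporadicEdges]) (f := ![b, b', x, y, x', y']) ⟨?_, ?_⟩ ?_
  · exact injective_vec_six (by
      simp [t.bx.ne, t.byy.ne, t.bx'.ne, t.by'.ne, t.b_b', t.b_x', t.b_y', t.x_y, t.x_b'.symm,
        t.x_x', t.x_y', t.y_b'.symm, t.y_x', t.y_y', t.x'_y'])
  · intro i
    rcases t.cover i with rfl | rfl | rfl | rfl | rfl | rfl
    exacts [⟨0, rfl⟩, ⟨2, rfl⟩, ⟨3, rfl⟩, ⟨1, rfl⟩, ⟨4, rfl⟩, ⟨5, rfl⟩]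
  · have e1 := t.bx
    have e2 := t.byy
    have e3 := t.bx'
    have e4 := t.by'
    have f1 := e1.symm
    have f2 := e2.symm
    have f3 := e3.symm
    have f4 := e4.symm
    have f5 := a1.symm
    rw [H.adj_comm] at d3 d4
    intro i j
    fin_cases i <;> fin_cases j <;>
      simp [ofEdges, listAdj, *] <;> rw [H.adj_comm] <;> assumption

/-- The remaining classes `e` and `f` are not adjacent to each other. If both hang on the same edge,
a perfect matching or a forbidden star appears; so they hang on different edges and form two
cherries. -/
theorem sporadic_of_two_edges_six (hG : IsSubcubic G) (h : Realizes G cl H)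
    (hV : 7 ≤ Fintype.card V)
    {a b c d e f : W} (hab : H.Adj a b) (hcd : H.Adj c d) (hac : a ≠ c) (had : a ≠ d)
    (hae : a ≠ e) (haf : a ≠ f) (hbc : b ≠ c) (hbd : b ≠ d) (hbe : b ≠ e) (hbf : b ≠ f)
    (hce : c ≠ e) (hcf : c ≠ f) (hde : d ≠ e) (hdf : d ≠ f) (hef : e ≠ f)
    (hcov : ∀ i, i = a ∨ i = b ∨ i = c ∨ i = d ∨ i = e ∨ i = f) :
    ∃ F ∈ sporadic, Nonempty (H ≃g F.2) := by
  have nef := h.no_perfect_matching_six hG hV hab hcd hac had hae haf hbc hbd hbe hbf hce hcf hde hdf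
  have main : ∀ {a b c d : W}, H.Adj a b → H.Adj c d → a ≠ c → a ≠ d → a ≠ e → a ≠ f → b ≠ c →
      b ≠ d → b ≠ e → b ≠ f → c ≠ e → c ≠ f → d ≠ e → d ≠ f →
      (∀ i, i = a ∨ i = b ∨ i = c ∨ i = d ∨ i = e ∨ i = f) → H.Adj b e →
      ∃ F ∈ sporadic, Nonempty (H ≃g F.2) := by
    intro a b c d hab hcd hac had hae haf hbc hbd hbe hbf hce hcf hde hdf hcov hbe'
    obtain ⟨j, hj⟩ := h.exists_adj hG (by omega) f
    rcases hcov j with rfl | rfl | rfl | rfl | rfl | rfl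
    · exact (h.no_perfect_matching_six hG hV hbe' hcd hbc hbd hab.ne.symm hbf hce.symm hde.symm
        hae.symm hef hac.symm hcf had.symm hdf hj.symm).elim
    · exact (h.no_star_and_edge_six hG hab.symm hbe' hbc hbd hae haf hac had hef hce.symm hde.symm
        hcf.symm hdf.symm hcd (fun i => by rcases hcov i with h | h | h | h | h | h <;> simp [h])
        hj.symm).elim
    · exact TwoCherries.iso (b := b) (x := a) (y := e) (b' := j) (x' := d) (y' := f)
        ⟨hab.symm, hbe', hcd, hj.symm, hbc, hbd, hbf, hae, hac, had, haf, hce.symm, hde.symm, hef,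
          hdf, fun i => by rcases hcov i with h | h | h | h | h | h <;> simp [h]⟩ hG h hV
    · exact TwoCherries.iso (b := b) (x := a) (y := e) (b' := j) (x' := c) (y' := f)
        ⟨hab.symm, hbe', hcd.symm, hj.symm, hbd, hbc, hbf, hae, had, hac, haf, hde.symm, hce.symm,
          hef, hcf, fun i => by rcases hcov i with h | h | h | h | h | h <;> simp [h]⟩ hG h hV
    · exact absurd hj.symm nef
    · exact absurd hj (H.loopless.irrefl _)
  obtain ⟨j, hj⟩ := h.exists_adj hG (by omega) e
  rcases hcov j with rfl | rfl | rfl | rfl | rfl | rfl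
  · exact main hab.symm hcd hbc hbd hbe hbf hac had hae haf hce hcf hde hdf
      (fun i => by rcases hcov i with h | h | h | h | h | h <;> simp [h]) hj.symm
  · exact main hab hcd hac had hae haf hbc hbd hbe hbf hce hcf hde hdf hcov hj.symm
  · exact main hcd.symm hab had.symm hbd.symm hde hdf hac.symm hbc.symm hce hcf hae haf hbe hbf
      (fun i => by rcases hcov i with h | h | h | h | h | h <;> simp [h]) hj.symm
  · exact main hcd hab hac.symm hbc.symm hce hcf had.symm hbd.symm hde hdf hae haf hbe hbf
      (fun i => by rcases hcov i with h | h | h | h | h | h <;> simp [h]) hj.symm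
  · exact absurd hj (H.loopless.irrefl _)
  · exact absurd hj nef

end TwoCherries


/-! ### Dominating vertices, orders four and five, and the case distinction. -/

variable {V : Type v} {W : Type u} {G : SimpleGraph V} {cl : W → Set V} {H : SimpleGraph W}

theorem card_index_le [Fintype V] [Fintype W] (h : Realizes G cl H) :
    Fintype.card W ≤ Fintype.card V := by
  rw [← h.sum_ncard, ← card_univ, card_eq_sum_ones]
  exact sum_le_sum fun i _ => h.one_le_ncard i

/-- If a class is a dominating vertex, the coalition graph has no edges. -/
theorem not_adj_of_dominating_vertex [Fintype V] (hG : IsSubcubic G) (h : Realizes G cl H)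
    {i : W} {x : V} (hi : IsConnectedDominating G (cl i)) (hx : cl i = {x}) (b c : W) :
    ¬ H.Adj b c := by
  classical
  intro hbc
  have hib : i ≠ b := by
    rintro rfl
    exact h.not_dominating hbc hi
  have hic : i ≠ c := by
    rintro rfl
    exact h.not_dominating hbc.symm hi
  have hV := hi.card_le hG
  rw [hx, Set.ncard_singleton] at hV
  have mx : x ∈ cl i := by rw [hx]; rfl
  have univ_x : ∀ w, w ≠ x → G.Adj w x := by
    intro w hw
    obtain ⟨y, hy, hwy⟩ := hi.1 w (by rwa [hx])
    rw [hx] at hy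
    obtain rfl := hy
    exact hwy
  have hs := h.sum_ncard_le {i, b, c}
  rw [sum_insert (by simp [hib, hic]), sum_pair hbc.ne, hx, Set.ncard_singleton] at hs
  have miss : ∀ {b c : W} {y : V}, H.Adj b c → cl b = {y} → ∃ w, w ≠ y ∧ ¬ G.Adj w y := by
    intro b c y hbc hy
    by_contra! hcon
    refine h.not_dominating hbc ?_
    rw [hy]
    refine ⟨fun w hw => ⟨y, rfl, hcon w hw⟩, (induce_connected_iff _).2 ⟨⟨y, rfl⟩, ?_⟩⟩
    intro S hS hne hSy
    exact absurd (Set.Nonempty.subset_singleton_iff hne |>.1 hS) hSy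
  -- The case `y = y'` covers a singleton `cl b`. Here `z` has a neighbour `u` in `cl b` and a
  -- non-neighbour `w`, so the vertices are exactly `x`, `z`, `u`, `w`. Then `w` must be adjacent to
  -- `u`, hence `u` is adjacent to all others and `cl b` alone dominates.
  have pair : ∀ {b c : W} {y y' z : V}, H.Adj b c → i ≠ b → i ≠ c → cl b = {y, y'} → cl c = {z} →
      False := by
    intro b c y y' z hbc hib hic hb hc
    have my : y ∈ cl b := by simp [hb]
    have my' : y' ∈ cl b := by simp [hb]
    have mz : z ∈ cl c := by simp [hc]
    obtain ⟨w, hwz, nwz⟩ := miss hbc.symm hc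
    obtain ⟨u, hu, hzu⟩ := h.exists_nbr_of_singleton hbc hc
    have nxy := h.ne_of_mem mx my hib
    have nxy' := h.ne_of_mem mx my' hib
    have nxz := h.ne_of_mem mx mz hic
    have nyz := h.ne_of_mem my mz hbc.ne
    have ny'z := h.ne_of_mem my' mz hbc.ne
    have hwx : w ≠ x := by
      rintro rfl
      exact nwz (univ_x z nxz.symm).symm
    have huw : u ≠ w := by
      rintro rfl
      exact nwz hzu.symm
    have hux : u ≠ x := fun h' => h.ne_of_mem mx hu hib h'.symm
    have huz : u ≠ z := h.ne_of_mem hu mz hbc.ne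
    have hall : ∀ t, t = x ∨ t = z ∨ t = u ∨ t = w := by
      intro t
      have : ({x, z, u, w} : Finset V) = univ := by
        refine eq_univ_of_card _ (le_antisymm (card_le_univ _) ?_)
        rw [card_insert_of_notMem (by simp [nxz, hux.symm, hwx.symm]),
          card_insert_of_notMem (by simp [huz.symm, hwz.symm]),
          card_insert_of_notMem (by simp [huw]), card_singleton]
        omega
      have ht : t ∈ ({x, z, u, w} : Finset V) := this ▸ mem_univ t
      simpa using ht
    have hwu : G.Adj w u := by
      obtain ⟨t, ht, hwt⟩ := h.exists_nbr hbc w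
      rcases hall t with rfl | rfl | rfl | rfl
      · rcases ht with ht | ht
        · exact absurd rfl (h.ne_of_mem mx ht hib)
        · exact absurd rfl (h.ne_of_mem mx ht hic)
      · exact absurd hwt nwz
      · exact hwt
      · exact absurd hwt (G.loopless.irrefl _)
    have hbsub : cl b ⊆ {u, w} := by
      intro t ht
      rcases hall t with rfl | rfl | rfl | rfl
      · exact absurd rfl (h.ne_of_mem mx ht hib)
      · exact absurd rfl (h.ne_of_mem ht mz hbc.ne)
      · exact Or.inl rfl
      · exact Or.inr rfl
    refine h.not_dominating hbc ⟨fun t ht => ⟨u, hu, ?_⟩, (induce_connected_iff _).2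
      ⟨⟨u, hu⟩, fun S hS hne hSb => ?_⟩⟩
    · rcases hall t with rfl | rfl | rfl | rfl
      · exact (univ_x u hux).symm
      · exact hzu
      · exact absurd hu ht
      · exact hwu
    · obtain ⟨s, hs⟩ := hne
      obtain ⟨t, ht, hts⟩ : ∃ t ∈ cl b, t ∉ S := by
        by_contra! hc
        exact hSb (hS.antisymm hc)
      have hst : s ≠ t := by
        rintro rfl
        exact hts hs
      refine ⟨s, hs, t, ht, hts, ?_⟩
      rcases hbsub (hS hs) with rfl | rfl <;> rcases hbsub ht with rfl | rfl
      · exact absurd rfl hst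
      · exact hwu.symm
      · exact hwu
      · exact absurd rfl hst
  have hb1 := h.one_le_ncard b
  have hc1 := h.one_le_ncard c
  have hcases : ((cl b).ncard = 1 ∨ (cl b).ncard = 2) ∧ (cl c).ncard = 1 ∨
      (cl b).ncard = 1 ∧ (cl c).ncard = 2 := by omega
  simp only [Set.ncard_eq_one, Set.ncard_eq_two] at hcases
  rcases hcases with ⟨⟨y, hy⟩ | ⟨y, y', -, hy⟩, ⟨z, hz⟩⟩ | ⟨⟨z, hz⟩, ⟨y, y', -, hy⟩⟩
  · exact pair hbc hib hic (y := y) (y' := y) (by simpa using hy) hz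
  · exact pair hbc hib hic hy hz
  · exact pair hbc.symm hic hib hy hz

theorem sporadic_of_no_edges [Finite W] [Nonempty W] (hH : ∀ i j, ¬ H.Adj i j)
    (hW : Nat.card W ≤ 4) : ∃ F ∈ sporadic, Nonempty (H ≃g F.2) := by
  have := Fintype.ofFinite W
  rw [Nat.card_eq_fintype_card] at hW
  have hpos := Fintype.card_pos (α := W)
  refine sporadic_of_table (k := Fintype.card W) (es := []) ?_ (Fintype.equivFin W).symm.bijective ?_
  · have : Fintype.card W = 1 ∨ Fintype.card W = 2 ∨ Fintype.card W = 3 ∨ Fintype.card W = 4 := by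
      omega
    rcases this with h | h | h | h <;> simp [h, sporadicEdges]
  · intro i j
    simp [hH, ofEdges, listAdj]

theorem sporadic_of_card_four [Fintype W] (hW : Fintype.card W = 4) {a b c d : W}
    (hab : H.Adj a b) (hcd : H.Adj c d) (hac : a ≠ c) (had : a ≠ d) (hbc : b ≠ c) (hbd : b ≠ d) :
    ∃ F ∈ sporadic, Nonempty (H ≃g F.2) := by
  classical
  have hinj : Function.Injective ![a, b, c, d] := by
    rw [← List.nodup_ofFn]
    simp [List.ofFn_succ, hab.ne, hcd.ne, hac, had, hbc, hbd]
  refine (matches4 (decide (H.Adj a c)) (decide (H.Adj a d)) (decide (H.Adj b c))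
    (decide (H.Adj b d))).exists_iso perms4_injective
    ((Fintype.bijective_iff_injective_and_card ![a, b, c, d]).2 ⟨hinj, by simp [hW]⟩) ?_
  intro i j
  fin_cases i <;> fin_cases j <;> simp [table4, hab, hcd, hab.symm, hcd.symm, H.adj_comm]

theorem sporadic_of_card_five [Fintype V] [Fintype W] (hG : IsSubcubic G) (h : Realizes G cl H)
    (hW : Fintype.card W = 5) {a b c d e : W} (hab : H.Adj a b) (hcd : H.Adj c d) (hae : H.Adj a e)
    (hac : a ≠ c) (had : a ≠ d) (hbc : b ≠ c) (hbd : b ≠ d) (hbe : b ≠ e) (hce : c ≠ e)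
    (hde : d ≠ e) : ∃ F ∈ sporadic, Nonempty (H ≃g F.2) := by
  classical
  have hinj : Function.Injective ![a, b, c, d, e] := by
    rw [← List.nodup_ofFn]
    simp [List.ofFn_succ, hab.ne, hcd.ne, hac, had, hbc, hbd, hae.ne, hbe, hce, hde]
  have hbij := (Fintype.bijective_iff_injective_and_card ![a, b, c, d, e]).2 ⟨hinj, by simp [hW]⟩
  have ht : ∀ i j, H.Adj (![a, b, c, d, e] i) (![a, b, c, d, e] j) ↔
      table5 (decide (H.Adj a c)) (decide (H.Adj a d)) (decide (H.Adj b c)) (decide (H.Adj b d))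
        (decide (H.Adj b e)) (decide (H.Adj c e)) (decide (H.Adj d e)) i j = true := by
    intro i j
    fin_cases i <;> fin_cases j <;>
      simp [table5, hab, hcd, hae, hab.symm, hcd.symm, hae.symm, H.adj_comm]
  -- Five distinct positions exhaust the classes; this supplies the covering hypotheses of the two
  -- obstructions.
  have cov : ∀ {i j k l m : Fin 5}, [i, j, k, l, m].Nodup → ∀ x, x = ![a, b, c, d, e] i ∨
      x = ![a, b, c, d, e] j ∨ x = ![a, b, c, d, e] k ∨ x = ![a, b, c, d, e] l ∨
      x = ![a, b, c, d, e] m := by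
    intro i j k l m hnd x
    obtain ⟨y, rfl⟩ := hbij.2 x
    simp only [hinj.eq_iff]
    have h1 : ([i, j, k, l, m].toFinset).card = 5 := List.toFinset_card_of_nodup hnd
    have h2 : [i, j, k, l, m].toFinset = univ := eq_univ_of_card _ h1
    have h3 : y ∈ [i, j, k, l, m].toFinset := h2 ▸ mem_univ y
    simpa using h3
  rcases matches5 (decide (H.Adj a c)) (decide (H.Adj a d)) (decide (H.Adj b c))
    (decide (H.Adj b d)) (decide (H.Adj b e)) (decide (H.Adj c e)) (decide (H.Adj d e)) with
    ⟨i, j, ij, k, ik, jk, l, il, jl, kl, m, im, jm, km, lm⟩ |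
    ⟨i, j, ij, k, ik, jk, l, il, jl, kl, m, im, km, lm, jm⟩ | hm
  · rw [← ht] at ij ik jk lm
    refine (h.no_triangle_and_edge hG (cov ?_) ij ik jk (hinj.ne il) (hinj.ne im) (hinj.ne jl)
      (hinj.ne jm) (hinj.ne kl) (hinj.ne km) lm).elim
    have n1 := ne_of_apply_ne _ ij.ne
    have n2 := ne_of_apply_ne _ ik.ne
    have n3 := ne_of_apply_ne _ jk.ne
    have n4 := ne_of_apply_ne _ lm.ne
    simp [*]
  · rw [← ht] at ij ik jk il jl jm
    refine (h.no_dart hG (cov ?_) ij ik jk il jl (hinj.ne kl) (hinj.ne im) (hinj.ne km)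
      (hinj.ne lm) jm).elim
    have n1 := ne_of_apply_ne _ ij.ne
    have n2 := ne_of_apply_ne _ ik.ne
    have n3 := ne_of_apply_ne _ jk.ne
    have n4 := ne_of_apply_ne _ il.ne
    have n5 := ne_of_apply_ne _ jl.ne
    have n6 := ne_of_apply_ne _ jm.ne
    simp [*]
  · exact hm.exists_iso perms5_injective hbij ht

theorem star_or_sporadic [Finite V] (hG : IsSubcubic G) (h : Realizes G cl H) :
    (∃ k : ℕ, 2 ≤ k ∧ Nonempty (H ≃g star k)) ∨ ∃ F ∈ sporadic, Nonempty (H ≃g F.2) := by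
  classical
  have := Fintype.ofFinite V
  have := h.finite_index
  have := Fintype.ofFinite W
  obtain ⟨x₀⟩ := hG.1.nonempty
  obtain ⟨i₀, -⟩ := h.cover x₀
  have hne : Nonempty W := ⟨i₀⟩
  by_cases hiso : ∃ i, IsConnectedDominating G (cl i) ∧ ∃ x, cl i = {x}
  · obtain ⟨i, hi, x, hx⟩ := hiso
    have h1 := hi.card_le hG
    rw [hx, Set.ncard_singleton] at h1
    have h2 := h.card_index_le
    exact Or.inr (sporadic_of_no_edges (h.not_adj_of_dominating_vertex hG hi hx)
      (by rw [Nat.card_eq_fintype_card]; omega))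
  have hadj : ∀ i, ∃ j, H.Adj i j := fun i =>
    (h.single_or_adj i).resolve_left fun h' => hiso ⟨i, h'⟩
  by_cases hmat : ∀ a b c d, H.Adj a b → H.Adj c d → a ≠ c → a ≠ d → b ≠ c → b ≠ d → False
  · exact star_or_triangle hadj hmat
  right
  push Not at hmat
  obtain ⟨a, b, c, d, hab, hcd, hac, had, hbc, hbd, -⟩ := hmat
  set Q : Finset W := {a, b, c, d} with hQ
  have hQ4 : #Q = 4 := by
    rw [hQ, card_insert_of_notMem (by simp [hab.ne, hac, had]),
      card_insert_of_notMem (by simp [hbc, hbd]), card_insert_of_notMem (by simp [hcd.ne]),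
      card_singleton]
  have hrest := h.sum_ncard_rest_le hG hab hcd hac had hbc hbd Qᶜ (by simp [hQ]) (by simp [hQ])
    (by simp [hQ]) (by simp [hQ])
  have hrest' : #Qᶜ ≤ ∑ i ∈ Qᶜ, (cl i).ncard := by
    rw [card_eq_sum_ones]
    exact sum_le_sum fun i _ => h.one_le_ncard i
  have hcard := card_add_card_compl Q
  have hmem : ∀ {i}, i ∉ Qᶜ → i = a ∨ i = b ∨ i = c ∨ i = d := by
    intro i hi
    rw [mem_compl, not_not] at hi
    simpa [hQ] using hi
  have hne' : ∀ {i}, i ∈ Qᶜ → a ≠ i ∧ b ≠ i ∧ c ≠ i ∧ d ≠ i := by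
    intro i hi
    simpa [hQ, eq_comm] using hi
  have : #Qᶜ = 0 ∨ #Qᶜ = 1 ∨ #Qᶜ = 2 := by omega
  rcases this with h0 | h1 | h2
  · exact sporadic_of_card_four (by omega) hab hcd hac had hbc hbd
  · obtain ⟨e, he⟩ := card_eq_one.1 h1
    obtain ⟨hae, hbe, hce, hde⟩ := hne' (i := e) (by simp [he])
    obtain ⟨j, hj⟩ := hadj e
    have hW : Fintype.card W = 5 := by omega
    have hjQ : j ∉ Qᶜ := by
      rw [he, mem_singleton]
      exact hj.ne.symm
    rcases hmem hjQ with rfl | rfl | rfl | rfl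
    · exact h.sporadic_of_card_five hG hW hab hcd hj.symm hac had hbc hbd hbe hce hde
    · exact h.sporadic_of_card_five hG hW hab.symm hcd hj.symm hbc hbd hac had hae hce hde
    · exact h.sporadic_of_card_five hG hW hcd hab hj.symm hac.symm hbc.symm had.symm hbd.symm hde
        hae hbe
    · exact h.sporadic_of_card_five hG hW hcd.symm hab hj.symm had.symm hbd.symm hac.symm hbc.symm
        hce hae hbe
  · obtain ⟨e, f, hef, he⟩ := card_eq_two.1 h2
    obtain ⟨hae, hbe, hce, hde⟩ := hne' (i := e) (by simp [he])
    obtain ⟨haf, hbf, hcf, hdf⟩ := hne' (i := f) (by simp [he])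
    have hW : Fintype.card W = 6 := by omega
    have hV := h.card_index_le
    -- The three-edge and triangle obstructions need a seventh vertex; with exactly six vertices all
    -- classes are singletons.
    rcases Nat.lt_or_ge 6 (Fintype.card V) with hV' | hV'
    · refine h.sporadic_of_two_edges_six hG hV' hab hcd hac had hae haf hbc hbd hbe hbf hce hcf hde
        hdf hef fun i => ?_
      by_cases hi : i ∈ Qᶜ
      · rw [he] at hi
        rcases mem_insert.1 hi with h' | h'
        · simp [h']
        · simp [mem_singleton.1 h']
      · rcases hmem hi with h' | h' | h' | h' <;> simp [h']
    · exact h.sporadic_of_card_six hG (by omega) hW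

end Realizes

/-! ### Realization of the stars. -/

section Connected

variable {V : Type v} {G : SimpleGraph V}

theorem IsConnectedDominating.connected {D : Set V} (h : IsConnectedDominating G D) :
    G.Connected := by
  obtain ⟨d, hd⟩ := h.nonempty
  rw [SimpleGraph.connected_iff_exists_forall_reachable]
  refine ⟨d, fun w => ?_⟩
  have key : ∀ z ∈ D, G.Reachable d z := fun z hz =>
    (h.2.preconnected ⟨d, hd⟩ ⟨z, hz⟩).map (SimpleGraph.Embedding.induce D).toHom
  by_cases hw : w ∈ D
  · exact key w hw
  · obtain ⟨z, hz, hwz⟩ := h.1 w hw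
    exact (key z hz).trans hwz.symm.reachable

end Connected

section Stars

/-- Adjacency in two paths of order `m + 1`, joined by `m` subdivided rungs. -/
def rungAdj (m : ℕ) : (Fin (m + 1) × Bool) ⊕ Fin m → (Fin (m + 1) × Bool) ⊕ Fin m → Prop
  | .inl p, .inl q => p.2 = q.2 ∧ (p.1.1 + 1 = q.1.1 ∨ q.1.1 + 1 = p.1.1)
  | .inl p, .inr j => p.1.1 = j.1
  | .inr j, .inl p => p.1.1 = j.1
  | .inr _, .inr _ => False

/-- Two paths of order `m + 1`, joined by `m` subdivided rungs. -/
def rungGraph (m : ℕ) : SimpleGraph (ULift.{v} ((Fin (m + 1) × Bool) ⊕ Fin m)) where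
  Adj x y := rungAdj m x.down y.down
  symm := ⟨by
    rintro ⟨⟨i, b⟩ | i⟩ ⟨⟨j, c⟩ | j⟩ h
    · exact ⟨h.1.symm, h.2.symm⟩
    · exact h
    · exact h
    · exact h⟩
  loopless := ⟨by
    rintro ⟨⟨i, b⟩ | i⟩ h
    · have := h.2
      omega
    · exact h⟩

variable {m : ℕ}

/-- Neighbours of a path vertex are coded as later, earlier or rung, those of a rung vertex by the
path they lie on. -/
theorem rungGraph_degree (x : ULift.{v} ((Fin (m + 1) × Bool) ⊕ Fin m)) :
    ((rungGraph m).neighborSet x).encard ≤ 3 := by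
  obtain ⟨x⟩ := x
  let code : ULift.{v} ((Fin (m + 1) × Bool) ⊕ Fin m) → Fin 3 := fun y =>
    match x, y.down with
    | .inl p, .inl q => if p.1 < q.1 then 0 else 1
    | .inl _, .inr _ => 2
    | .inr _, .inl q => if q.2 then 0 else 1
    | .inr _, .inr _ => 2
  have hinj : Set.InjOn code ((rungGraph m).neighborSet ⟨x⟩) := by
    rintro ⟨y⟩ hy ⟨z⟩ hz hyz
    rcases x with ⟨i, b⟩ | i <;> rcases y with ⟨j, c⟩ | j <;> rcases z with ⟨k, d⟩ | k <;>
      simp only [SimpleGraph.mem_neighborSet, rungGraph, rungAdj, code] at hy hz hyz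
    · obtain ⟨rfl, hy⟩ := hy
      obtain ⟨rfl, hz⟩ := hz
      have : j = k := by
        apply Fin.ext
        simp only [Fin.lt_def] at hyz
        split_ifs at hyz <;> omega
      rw [this]
    · split_ifs at hyz <;> exact absurd hyz (by decide)
    · split_ifs at hyz <;> exact absurd hyz (by decide)
    · have : j = k := Fin.ext (by omega)
      rw [this]
    · have h1 : j = k := Fin.ext (by omega)
      have h2 : c = d := by cases c <;> cases d <;> simp_all
      rw [h1, h2]
  refine (Set.encard_le_encard_of_injOn (t := Set.univ) (fun _ _ => Set.mem_univ _) hinj).trans ?_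
  rw [Set.encard_univ, ENat.card_eq_coe_fintype_card, Fintype.card_fin]
  rfl

/-- The partition of `rungGraph m` into the two paths and the inner vertices of the rungs. -/
def rungClass (m : ℕ) (i : Fin (m + 1)) : Set (ULift.{v} ((Fin (m + 1) × Bool) ⊕ Fin m)) :=
  {x | match x.down with
    | .inl _ => i = 0
    | .inr j => i = j.succ}

/-- One rung vertex links the two paths, and every other rung vertex is adjacent to them. -/
theorem rungClass_dominating (j : Fin m) : IsConnectedDominating (rungGraph.{v} m)
    (rungClass m 0 ∪ rungClass m j.succ) := by
  constructor
  · rintro ⟨⟨i, b⟩ | i⟩ hx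
    · exact absurd (Or.inl rfl) hx
    · exact ⟨⟨.inl (i.castSucc, true)⟩, Or.inl rfl, rfl⟩
  · have row : ∀ b : Bool, ((rungGraph.{v} m).induce
        {x | ∃ i, x = ⟨.inl (i, b)⟩}).Connected := by
      intro b
      rw [SimpleGraph.connected_iff_exists_forall_reachable]
      refine ⟨⟨⟨.inl (0, b)⟩, 0, rfl⟩, ?_⟩
      rintro ⟨_, i, rfl⟩
      induction i using Fin.induction with
      | zero => exact SimpleGraph.Reachable.refl _
      | succ i ih =>
        refine ih.trans (SimpleGraph.Adj.reachable ?_)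
        exact ⟨rfl, Or.inl (by simp)⟩
    have sing : ((rungGraph.{v} m).induce {⟨.inr j⟩}).Preconnected := by
      rintro ⟨_, rfl⟩ ⟨_, rfl⟩
      exact SimpleGraph.Reachable.refl _
    have adj : ∀ b, (rungGraph.{v} m).Adj ⟨.inl (j.castSucc, b)⟩ ⟨.inr j⟩ := fun _ => rfl
    have h1 := SimpleGraph.connected_induce_union (row true).preconnected sing ⟨_, rfl⟩ rfl
      (adj true)
    have h2 := SimpleGraph.connected_induce_union (row false).preconnected h1.preconnected
      ⟨_, rfl⟩ (Or.inr rfl) (adj false)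
    have hset : rungClass.{v} m 0 ∪ rungClass m j.succ =
        {x | ∃ i, x = ⟨.inl (i, false)⟩} ∪ ({x | ∃ i, x = ⟨.inl (i, true)⟩} ∪ {⟨.inr j⟩}) := by
      ext ⟨⟨i, b⟩ | i⟩
      · cases b <;> simp [rungClass]
      · simp [rungClass, eq_comm]
    rwa [hset]

/-- The two paths have no edge between them, and a rung vertex misses the last column, which carries
no rung. -/
theorem rungClass_not_dominating (i : Fin (m + 1)) :
    ¬ IsConnectedDominating (rungGraph.{v} m) (rungClass m i) := by
  intro h
  refine Fin.cases (fun h => ?_) (fun j h => ?_) i h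
  · obtain ⟨⟨⟨p, b⟩ | p⟩, ⟨k, hk⟩, ⟨⟨q, c⟩ | q⟩, hy, hyS, hadj⟩ :=
      h.cut (S := {x | ∃ i, x = ⟨.inl (i, true)⟩})
        (by rintro _ ⟨k, rfl⟩; rfl) ⟨_, 0, rfl⟩ (by
          intro heq
          have : (⟨.inl (0, false)⟩ : ULift ((Fin (m + 1) × Bool) ⊕ Fin m)) ∈ rungClass.{v} m 0 :=
            rfl
          rw [← heq] at this
          obtain ⟨k, hk⟩ := this
          simp at hk)
    · have h1 := hadj.1
      simp only [ULift.up.injEq, Sum.inl.injEq, Prod.mk.injEq] at hk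
      simp only at h1
      exact hyS ⟨q, by rw [← h1, hk.2]⟩
    · exact absurd hy (Fin.succ_ne_zero q).symm
    · simp at hk
    · exact absurd hy (Fin.succ_ne_zero q).symm
  · obtain ⟨⟨⟨q, c⟩ | q⟩, hy, hadj⟩ := h.1 ⟨.inl (Fin.last m, true)⟩ (Fin.succ_ne_zero j)
    · exact absurd hy (Fin.succ_ne_zero j)
    · have : m = q.1 := hadj
      omega

theorem star_isSubcubicCoalitionGraph {k : ℕ} (hk : 2 ≤ k) :
    IsSubcubicCoalitionGraph.{0, v} (star k) := by
  obtain ⟨m, rfl⟩ : ∃ m, k = m + 1 + 1 := ⟨k - 2, by omega⟩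
  rw [isSubcubicCoalitionGraph_iff]
  have hadj : ∀ i j, (star (m + 1 + 1)).Adj i j ↔
      FormCoalition (rungGraph.{v} (m + 1)) (rungClass (m + 1) i) (rungClass (m + 1) j) := by
    intro i j
    rw [star, SimpleGraph.starGraph_adj]
    constructor
    · rintro ⟨hij, h⟩
      refine ⟨?_, rungClass_not_dominating i, rungClass_not_dominating j, ?_⟩
      · rw [Set.disjoint_left]
        rintro ⟨x | x⟩ hi hj
        · exact hij (Eq.trans hi (Eq.symm hj))
        · exact hij (Eq.trans hi (Eq.symm hj))
      · rcases h with rfl | rfl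
        · obtain ⟨j, rfl⟩ := Fin.exists_succ_eq.2 (Ne.symm hij)
          exact rungClass_dominating j
        · obtain ⟨i, rfl⟩ := Fin.exists_succ_eq.2 hij
          rw [Set.union_comm]
          exact rungClass_dominating i
    · rintro ⟨hdis, hi, -, hd⟩
      have hij : i ≠ j := by
        rintro rfl
        rw [Set.union_self] at hd
        exact hi hd
      refine ⟨hij, ?_⟩
      by_contra! hc
      -- Two rung vertices together still miss the last column, so an edge must use class `0`.
      obtain ⟨⟨⟨q, c⟩ | q⟩, hy, hadj⟩ := hd.1 ⟨.inl (Fin.last (m + 1), true)⟩ (by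
        rintro (h | h)
        exacts [hc.1 h, hc.2 h])
      · rcases hy with h | h
        exacts [hc.1 h, hc.2 h]
      · have : m + 1 = q.1 := hadj
        omega
  refine ⟨_, inferInstance, rungGraph (m + 1), rungClass (m + 1),
    ⟨(rungClass_dominating 0).connected, rungGraph_degree⟩, ?_, ?_, ?_, hadj, ?_⟩
  · intro i
    refine Fin.cases ⟨⟨.inl (0, true)⟩, rfl⟩ (fun j => ⟨⟨.inr j⟩, rfl⟩) i
  · intro i j hij
    rw [Set.disjoint_left]
    rintro ⟨x | x⟩ hi hj
    · exact hij (Eq.trans hi (Eq.symm hj))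
    · exact hij (Eq.trans hi (Eq.symm hj))
  · rintro ⟨x | x⟩
    exacts [⟨0, rfl⟩, ⟨x.succ, rfl⟩]
  · refine fun i => Or.inr (Fin.cases ⟨1, ?_⟩ (fun j => ⟨0, ?_⟩) i)
    · simp [star]
    · simp [star]

end Stars

/-! ### Certificates for explicit realizations. -/

section Checker

variable {n : ℕ}

/-- The vertices of `D` reached from `S` in `k` steps inside `D`. -/
def grow (adj : Fin n → Fin n → Bool) (D : List (Fin n)) : ℕ → List (Fin n) → List (Fin n)
  | 0, S => S
  | k + 1, S => grow adj D k (D.filter fun x => S.contains x || S.any (adj x))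

/-- The connected component of the first element of `D` in the graph induced by `D`. -/
def firstComponent (adj : Fin n → Fin n → Bool) : List (Fin n) → List (Fin n)
  | [] => []
  | d :: D => grow adj (d :: D) n [d]

def isDominatingList (adj : Fin n → Fin n → Bool) (D : List (Fin n)) : Bool :=
  (List.finRange n).all fun x => D.contains x || D.any (adj x)

/-- A certificate that the list is a connected dominating set. -/
def certifyCDS (adj : Fin n → Fin n → Bool) (D : List (Fin n)) : Bool :=
  isDominatingList adj D && !D.isEmpty && D.all fun x => (firstComponent adj D).contains x

/-- A certificate that the list is not a connected dominating set. -/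
def refuteCDS (adj : Fin n → Fin n → Bool) (D : List (Fin n)) : Bool :=
  !isDominatingList adj D ||
    (D.any fun x => (firstComponent adj D).contains x) &&
      (D.any fun x => !(firstComponent adj D).contains x) &&
      D.all fun x => (firstComponent adj D).contains x || !(firstComponent adj D).any (adj x)

variable {V : Type v} {G : SimpleGraph V} {e : V ≃ Fin n} {adj : Fin n → Fin n → Bool}

theorem isDominatingList_iff (hadj : ∀ x y, G.Adj x y ↔ adj (e x) (e y) = true)
    (D : List (Fin n)) : isDominatingList adj D = true ↔
      ∀ x, x ∉ {x | e x ∈ D} → ∃ y ∈ {x | e x ∈ D}, G.Adj x y := by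
  simp only [isDominatingList, List.all_eq_true, List.mem_finRange, forall_const, Bool.or_eq_true,
    List.contains_iff_mem, List.any_eq_true, Set.mem_ofPred_eq, hadj]
  constructor
  · intro h x hx
    obtain ⟨y, hy, hxy⟩ := (h (e x)).resolve_left hx
    exact ⟨e.symm y, by simpa using hy, by simpa using hxy⟩
  · intro h x
    by_cases hx : x ∈ D
    · exact Or.inl hx
    · obtain ⟨y, hy, hxy⟩ := h (e.symm x) (by simpa using hx)
      exact Or.inr ⟨e y, hy, by simpa using hxy⟩

theorem reachable_of_mem_grow (hadj : ∀ x y, G.Adj x y ↔ adj (e x) (e y) = true)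
    {D : List (Fin n)} (d : {x | e x ∈ D}) (k : ℕ) : ∀ S : List (Fin n),
    (∀ y, e y ∈ S → ∃ hy : e y ∈ D, (G.induce {x | e x ∈ D}).Reachable d ⟨y, hy⟩) →
    ∀ y, e y ∈ grow adj D k S → ∃ hy : e y ∈ D, (G.induce {x | e x ∈ D}).Reachable d ⟨y, hy⟩ := by
  induction k with
  | zero => exact fun S h => h
  | succ k ih =>
    intro S h
    refine ih _ fun y hy => ?_
    rw [List.mem_filter, Bool.or_eq_true, List.contains_iff_mem, List.any_eq_true] at hy
    obtain ⟨hyD, hyS | ⟨z, hz, hyz⟩⟩ := hy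
    · exact h y hyS
    · obtain ⟨hzD, hr⟩ := h (e.symm z) (by simpa using hz)
      refine ⟨hyD, hr.trans (SimpleGraph.Adj.reachable ?_)⟩
      refine SimpleGraph.Adj.symm ((hadj _ _).2 ?_)
      simpa using hyz

theorem certifyCDS_sound (hadj : ∀ x y, G.Adj x y ↔ adj (e x) (e y) = true)
    {D : List (Fin n)} (h : certifyCDS adj D = true) :
    IsConnectedDominating G {x | e x ∈ D} := by
  rw [certifyCDS, Bool.and_eq_true, Bool.and_eq_true, List.all_eq_true] at h
  obtain ⟨⟨h1, h2⟩, h3⟩ := h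
  refine ⟨(isDominatingList_iff hadj D).1 h1, ?_⟩
  cases D with
  | nil => simp at h2
  | cons d D =>
    rw [SimpleGraph.connected_iff_exists_forall_reachable]
    have hd : e (e.symm d) ∈ d :: D := by simp
    refine ⟨⟨e.symm d, hd⟩, ?_⟩
    rintro ⟨y, hy⟩
    have hy' := h3 (e y) hy
    rw [List.contains_iff_mem] at hy'
    refine (reachable_of_mem_grow hadj ⟨e.symm d, hd⟩ n [d] ?_ y hy').2
    intro z hz
    rw [List.mem_singleton] at hz
    obtain rfl : z = e.symm d := by rw [← hz, Equiv.symm_apply_apply]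
    exact ⟨hd, SimpleGraph.Reachable.refl _⟩

/-- The refutation itself checks that the computed list is a nonempty proper part of `D` that no
edge leaves, so completeness of `grow` is not needed. -/
theorem refuteCDS_sound (hadj : ∀ x y, G.Adj x y ↔ adj (e x) (e y) = true)
    {D : List (Fin n)} (h : refuteCDS adj D = true) :
    ¬ IsConnectedDominating G {x | e x ∈ D} := by
  intro hcd
  rw [refuteCDS, (isDominatingList_iff hadj D).2 hcd.1, Bool.not_true, Bool.false_or,
    Bool.and_eq_true, Bool.and_eq_true, List.all_eq_true, List.any_eq_true, List.any_eq_true] at h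
  obtain ⟨⟨⟨s, hs, hs'⟩, ⟨t, ht, ht'⟩⟩, hclosed⟩ := h
  rw [List.contains_iff_mem] at hs'
  obtain ⟨x, hx, y, hy, hyS, hxy⟩ := hcd.cut (S := {x | e x ∈ D ∧ e x ∈ firstComponent adj D})
    (fun x hx => hx.1) ⟨e.symm s, by simpa using hs, by simpa using hs'⟩ (by
      intro heq
      have : e.symm t ∈ {x | e x ∈ D} := by simpa using ht
      rw [← heq] at this
      have h2 := this.2
      rw [Equiv.apply_symm_apply] at h2
      simp [h2] at ht')
  have hc := hclosed (e y) hy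
  rw [Bool.or_eq_true, List.contains_iff_mem] at hc
  rcases hc with hc | hc
  · exact hyS ⟨hy, hc⟩
  · rw [Bool.not_eq_true', ← Bool.not_eq_true] at hc
    exact hc (List.any_eq_true.2 ⟨e x, hx.2, (hadj _ _).1 hxy.symm⟩)

/-- The vertices whose colour satisfies `p`. -/
def colourClass (n : ℕ) (col : List ℕ) (p : ℕ → Bool) : List (Fin n) :=
  (List.finRange n).filter fun x => p (col.getD x 0)

/-- The colouring `col` of the graph with `n` vertices and edge list `es` is a connected coalition
partition whose coalition graph has `k` vertices and edge list `F`. -/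
structure IsTableRealization (k : ℕ) (F : List (ℕ × ℕ)) (n : ℕ) (es : List (ℕ × ℕ))
    (col : List ℕ) : Prop where
  irrefl : ∀ x : Fin n, listAdj es x x = false
  connected : certifyCDS (listAdj es) (List.finRange n) = true
  degree : ∀ x : Fin n, ((List.finRange n).filter (listAdj es x)).length ≤ 3
  cover : ∀ x : Fin n, ∃ i : Fin k, col.getD x 0 = i
  nonempty : ∀ i : Fin k, ∃ x : Fin n, col.getD x 0 = i
  adj : ∀ i j : Fin k, i ≠ j → listAdj F i j = true →
    refuteCDS (listAdj es) (colourClass n col (· == i)) = true ∧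
    certifyCDS (listAdj es) (colourClass n col fun c => c == i || c == j) = true
  -- A missing edge comes either from a class that is already connected dominating, as for
  -- dominating vertices, or from a union that is not.
  not_adj : ∀ i j : Fin k, i ≠ j → listAdj F i j = false →
    certifyCDS (listAdj es) (colourClass n col (· == i)) = true ∨
    refuteCDS (listAdj es) (colourClass n col fun c => c == i || c == j) = true
  single_or_adj : ∀ i : Fin k, (∃ j, i ≠ j ∧ listAdj F i j = true) ∨
    (certifyCDS (listAdj es) (colourClass n col (· == i)) = true ∧
      ∃ x, colourClass n col (· == i) = [x])

instance (k : ℕ) (F : List (ℕ × ℕ)) (n : ℕ) (es : List (ℕ × ℕ)) (col : List ℕ) :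
    Decidable (IsTableRealization k F n es col) :=
  decidable_of_iff
    ((∀ x : Fin n, listAdj es x x = false) ∧
      certifyCDS (listAdj es) (List.finRange n) = true ∧
      (∀ x : Fin n, ((List.finRange n).filter (listAdj es x)).length ≤ 3) ∧
      (∀ x : Fin n, ∃ i : Fin k, col.getD x 0 = i) ∧
      (∀ i : Fin k, ∃ x : Fin n, col.getD x 0 = i) ∧
      (∀ i j : Fin k, i ≠ j → listAdj F i j = true →
        refuteCDS (listAdj es) (colourClass n col (· == i)) = true ∧
        certifyCDS (listAdj es) (colourClass n col fun c => c == i || c == j) = true) ∧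
      (∀ i j : Fin k, i ≠ j → listAdj F i j = false →
        certifyCDS (listAdj es) (colourClass n col (· == i)) = true ∨
        refuteCDS (listAdj es) (colourClass n col fun c => c == i || c == j) = true) ∧
      ∀ i : Fin k, (∃ j, i ≠ j ∧ listAdj F i j = true) ∨
        (certifyCDS (listAdj es) (colourClass n col (· == i)) = true ∧
          ∃ x, colourClass n col (· == i) = [x]))
    ⟨fun ⟨h1, h2, h3, h4, h5, h6, h7, h8⟩ => ⟨h1, h2, h3, h4, h5, h6, h7, h8⟩,
      fun ⟨h1, h2, h3, h4, h5, h6, h7, h8⟩ => ⟨h1, h2, h3, h4, h5, h6, h7, h8⟩⟩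

theorem listAdj_comm {k : ℕ} (es : List (ℕ × ℕ)) (i j : Fin k) :
    listAdj es i j = listAdj es j i :=
  congrArg _ (funext fun _ => Bool.or_comm _ _)

theorem IsTableRealization.isSubcubicCoalitionGraph {k : ℕ} {F : List (ℕ × ℕ)} {n : ℕ}
    {es : List (ℕ × ℕ)} {col : List ℕ} (h : IsTableRealization k F n es col) :
    IsSubcubicCoalitionGraph.{0, v} (ofEdges k F) := by
  rw [isSubcubicCoalitionGraph_iff]
  let e : ULift.{v} (Fin n) ≃ Fin n := Equiv.ulift
  let G : SimpleGraph (ULift.{v} (Fin n)) := (ofEdges n es).comap e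
  have hadj : ∀ x y, G.Adj x y ↔ listAdj es (e x) (e y) = true := by
    intro x y
    refine ⟨fun h' => h'.2, fun h' => ⟨?_, h'⟩⟩
    intro heq
    rw [heq, h.irrefl] at h'
    exact Bool.false_ne_true h'
  let cl : Fin k → Set (ULift.{v} (Fin n)) := fun i => {x | col.getD (e x) 0 = i}
  have cl_eq : ∀ i, cl i = {x | e x ∈ colourClass n col (· == i)} := by
    intro i
    ext x
    simp [cl, colourClass]
  have cl_union : ∀ i j, cl i ∪ cl j = {x | e x ∈ colourClass n col fun c => c == i || c == j} := by
    intro i j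
    ext x
    simp [cl, colourClass]
  have disj : ∀ i j, i ≠ j → Disjoint (cl i) (cl j) := by
    intro i j hij
    rw [Set.disjoint_left]
    intro x hi hj
    exact hij (Fin.ext (Eq.trans (Eq.symm hi) hj))
  refine ⟨ULift.{v} (Fin n), inferInstance, G, cl,
    ⟨(certifyCDS_sound hadj h.connected).connected, ?_⟩, ?_, disj, ?_, ?_, ?_⟩
  · intro x
    have hx := h.degree (e x)
    have hsub : G.neighborSet x ⊆
        e.symm '' (((List.finRange n).filter (listAdj es (e x))).toFinset : Set (Fin n)) := by
      intro y hy
      refine ⟨e y, ?_, by simp⟩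
      simpa using (hadj x y).1 hy
    refine (Set.encard_le_encard hsub).trans ((Set.encard_image_le _ _).trans ?_)
    rw [Set.encard_coe_eq_coe_finsetCard]
    exact_mod_cast (List.toFinset_card_le _).trans hx
  · intro i
    obtain ⟨x, hx⟩ := h.nonempty i
    exact ⟨e.symm x, by simpa [cl] using hx⟩
  · intro x
    obtain ⟨i, hi⟩ := h.cover (e x)
    exact ⟨i, hi⟩
  · intro i j
    constructor
    · rintro ⟨hij, hF⟩
      have h1 := h.adj i j hij hF
      have h2 := h.adj j i hij.symm (by rwa [listAdj_comm])
      refine ⟨disj i j hij, ?_, ?_, ?_⟩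
      · rw [cl_eq]
        exact refuteCDS_sound hadj h1.1
      · rw [cl_eq]
        exact refuteCDS_sound hadj h2.1
      · rw [cl_union]
        exact certifyCDS_sound hadj h1.2
    · rintro ⟨-, hi, -, hd⟩
      have hij : i ≠ j := by
        rintro rfl
        rw [Set.union_self] at hd
        exact hi hd
      refine ⟨hij, ?_⟩
      by_contra hF
      rw [Bool.not_eq_true] at hF
      rcases h.not_adj i j hij hF with h1 | h1
      · rw [cl_eq] at hi
        exact hi (certifyCDS_sound hadj h1)
      · rw [cl_union] at hd
        exact refuteCDS_sound hadj h1 hd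
  · intro i
    rcases h.single_or_adj i with ⟨j, hj⟩ | ⟨h1, x, hx⟩
    · exact Or.inr ⟨j, hj⟩
    · refine Or.inl ⟨?_, e.symm x, ?_⟩
      · rw [cl_eq]
        exact certifyCDS_sound hadj h1
      · rw [cl_eq, hx]
        ext y
        simp [Equiv.eq_symm_apply]

/-- For each graph of `sporadic`, a graph with a colouring that realizes it. -/
def realizations : List (ℕ × List (ℕ × ℕ) × List ℕ) :=
  [(1, [], [0]),
   (2, [(0, 1)], [1, 0]),
   (3, [(0, 1), (0, 2), (1, 2)], [2, 1, 0]),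
   (4, [(0, 1), (0, 2), (0, 3), (1, 2), (1, 3), (2, 3)], [3, 2, 1, 0]),
   (5, [(0, 3), (0, 4), (1, 2), (1, 4), (2, 3)], [2, 1, 1, 2, 0]),
   (6, [(0, 1), (0, 4), (1, 2), (1, 5), (2, 3), (2, 5), (3, 4), (3, 5)], [3, 2, 3, 1, 0, 0]),
   (5, [(0, 1), (0, 3), (0, 4), (1, 2), (1, 4), (2, 3)], [1, 2, 3, 0, 1]),
   (4, [(0, 2), (0, 3), (1, 2), (1, 3)], [3, 1, 2, 0]),
   (6, [(0, 1), (0, 4), (1, 2), (1, 5), (2, 3), (2, 5), (3, 4), (3, 5)], [0, 0, 2, 2, 1, 3]),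
   (6, [(0, 1), (0, 4), (1, 2), (1, 5), (2, 3), (2, 5), (3, 4), (3, 5)], [3, 3, 1, 2, 2, 0]),
   (8, [(0, 1), (0, 2), (0, 3), (1, 2), (1, 4), (2, 6), (3, 4), (3, 5), (4, 7), (5, 6),
    (5, 7), (6, 7)],
    [3, 2, 1, 3, 0, 2, 1, 0]),
   (6, [(0, 1), (0, 4), (0, 5), (1, 3), (1, 5), (2, 3), (2, 4), (2, 5), (3, 4)],
    [3, 1, 3, 0, 4, 2]),
   (6, [(0, 1), (0, 2), (0, 3), (1, 2), (1, 4), (2, 5), (3, 4), (3, 5)], [0, 1, 1, 2, 4, 3]),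
   (8, [(0, 1), (0, 2), (0, 3), (1, 2), (1, 4), (2, 6), (3, 4), (3, 5), (4, 7), (5, 6),
    (5, 7), (6, 7)],
    [3, 1, 2, 3, 1, 4, 2, 0]),
   (7, [(0, 1), (0, 5), (0, 6), (1, 2), (1, 3), (2, 4), (2, 5), (3, 4), (4, 6), (5, 6)],
    [1, 1, 0, 4, 0, 3, 2]),
   (10, [(0, 3), (0, 4), (0, 5), (1, 5), (1, 6), (1, 8), (2, 5), (2, 7), (2, 8), (3, 8),
    (3, 9), (4, 6), (4, 7), (6, 9), (7, 9)],
    [2, 0, 4, 1, 2, 0, 3, 0, 1, 0]),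
   (7, [(0, 1), (0, 2), (1, 3), (1, 4), (2, 5), (2, 6), (3, 5), (3, 6), (4, 5), (4, 6)],
    [4, 0, 2, 0, 2, 3, 1]),
   (8, [(0, 2), (0, 3), (0, 5), (1, 4), (1, 5), (1, 7), (2, 6), (2, 7), (3, 4), (3, 7),
    (4, 6), (5, 6)],
    [3, 4, 1, 3, 2, 4, 1, 0]),
   (8, [(0, 2), (0, 3), (0, 5), (1, 4), (1, 5), (1, 7), (2, 6), (2, 7), (3, 4), (3, 7),
    (4, 6), (5, 6)],
    [1, 3, 0, 1, 5, 4, 2, 0]),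
   (6, [(0, 1), (0, 4), (0, 5), (1, 3), (1, 5), (2, 3), (2, 4), (2, 5), (3, 4)],
    [3, 5, 1, 4, 2, 0]),
   (5, [(0, 2), (0, 3), (0, 4), (1, 2), (1, 3), (1, 4)], [1, 0, 4, 3, 2]),
   (6, [(0, 1), (0, 4), (0, 5), (1, 2), (1, 3), (2, 4), (2, 5), (3, 4), (3, 5)],
    [5, 2, 4, 3, 1, 0])]

theorem realizations_spec : ∀ p ∈ sporadicEdges.zip realizations,
    IsTableRealization p.1.1 p.1.2 p.2.1 p.2.2.1 p.2.2.2 := by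
  decide +kernel

theorem isSubcubicCoalitionGraph_of_mem_sporadic {F : (n : ℕ) × SimpleGraph (Fin n)}
    (hF : F ∈ sporadic) : IsSubcubicCoalitionGraph.{0, v} F.2 := by
  rw [sporadic_eq] at hF
  obtain ⟨t, ht, rfl⟩ := List.mem_map.1 hF
  -- The two lists match position by position and have equal length, so `zip` drops nothing.
  have hmap : (sporadicEdges.zip realizations).map Prod.fst = sporadicEdges :=
    List.map_fst_zip (by decide)
  rw [← hmap] at ht
  obtain ⟨p, hp, rfl⟩ := List.mem_map.1 ht
  exact (realizations_spec p hp).isSubcubicCoalitionGraph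

end Checker

theorem IsSubcubicCoalitionGraph.of_iso {W : Type u} {W' : Type*} {H : SimpleGraph W}
    {H' : SimpleGraph W'} (h : IsSubcubicCoalitionGraph.{_, v} H') (e : H ≃g H') :
    IsSubcubicCoalitionGraph.{u, v} H := by
  rw [isSubcubicCoalitionGraph_iff] at h ⊢
  obtain ⟨V, hV, G, cl, hG, hR⟩ := h
  exact ⟨V, hV, G, cl ∘ e, hG, hR.map_iso e⟩

/-! ### Degree sequences as isomorphism invariants. -/

section Code

/-- A number that encodes the degree sequence of a graph with at most nine vertices. -/
def degreeCode {n : ℕ} (F : SimpleGraph (Fin n)) [DecidableRel F.Adj] : ℕ :=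
  ∑ i, 10 ^ F.degree i

theorem degreeCode_eq_of_iso {n : ℕ} {F : SimpleGraph (Fin n)} [DecidableRel F.Adj] {m : ℕ}
    {F' : SimpleGraph (Fin m)} [DecidableRel F'.Adj] (e : F ≃g F') :
    degreeCode F = degreeCode F' :=
  Fintype.sum_equiv e.toEquiv _ _ fun i => by
    rw [← SimpleGraph.Iso.degree_eq e i]
    rfl

instance : (k : ℕ) → DecidableRel (star k).Adj
  | 0 => inferInstanceAs (DecidableRel (⊥ : SimpleGraph (Fin 0)).Adj)
  | k + 1 => inferInstanceAs (DecidableRel (SimpleGraph.starGraph (0 : Fin (k + 1))).Adj)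

theorem degreeCode_pairwise : sporadicEdges.Pairwise fun t t' =>
    degreeCode (ofEdges t.1 t.2) ≠ degreeCode (ofEdges t'.1 t'.2) := by
  decide +kernel

/-- An isomorphism fixes the order, so only the star of the same order has to be compared; `K₁` is
exempt because stars have order at least two. -/
theorem degreeCode_ne_star : ∀ t ∈ sporadicEdges, t.1 ≤ 6 ∧
    (2 ≤ t.1 → degreeCode (ofEdges t.1 t.2) ≠ degreeCode (star t.1)) := by
  decide +kernel

end Code

end CoalitionGraph

theorem theorem1 :
    (∀ (W : Type u) (H : SimpleGraph W),
      CoalitionGraph.IsSubcubicCoalitionGraph.{u, v} H ↔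
        (∃ k : ℕ, 2 ≤ k ∧ Nonempty (H ≃g CoalitionGraph.star k)) ∨
        (∃ F ∈ CoalitionGraph.sporadic, Nonempty (H ≃g F.2))) ∧
    CoalitionGraph.sporadic.length = 22 ∧
    CoalitionGraph.sporadic.Pairwise (fun F F' => IsEmpty (F.2 ≃g F'.2)) ∧
    (∀ F ∈ CoalitionGraph.sporadic,
      F.1 ≤ 6 ∧ ∀ k : ℕ, 2 ≤ k → IsEmpty (F.2 ≃g CoalitionGraph.star k)) := by
  refine ⟨fun W H => ⟨fun h => ?_, ?_⟩, rfl, ?_, ?_⟩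
  · obtain ⟨V, hV, G, cl, hG, hR⟩ := CoalitionGraph.isSubcubicCoalitionGraph_iff.1 h
    exact hR.star_or_sporadic hG
  · rintro (⟨k, hk, ⟨e⟩⟩ | ⟨F, hF, ⟨e⟩⟩)
    · exact (CoalitionGraph.star_isSubcubicCoalitionGraph hk).of_iso e
    · exact (CoalitionGraph.isSubcubicCoalitionGraph_of_mem_sporadic hF).of_iso e
  · rw [CoalitionGraph.sporadic_eq, List.pairwise_map]
    exact CoalitionGraph.degreeCode_pairwise.imp fun hne =>
      ⟨fun e => hne (CoalitionGraph.degreeCode_eq_of_iso e)⟩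
  · intro F hF
    rw [CoalitionGraph.sporadic_eq] at hF
    obtain ⟨t, ht, rfl⟩ := List.mem_map.1 hF
    obtain ⟨h6, hstar⟩ := CoalitionGraph.degreeCode_ne_star t ht
    refine ⟨h6, fun k hk => ⟨fun e => ?_⟩⟩
    obtain rfl : t.1 = k := by simpa using Fintype.card_congr e.toEquiv
    exact hstar hk (CoalitionGraph.degreeCode_eq_of_iso e)
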